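/- Let $n\ge 2$, let $H$ be a finite-dimensional rational vector space with a non-degenerate bilinear form $Q$ satisfying $Q(u,v)=(-1)^nQ(v,u)$, and let $D$ be the period domain of all Hodge structures of weight $n$ on $H$ polarized by $Q$ with given Hodge numbers $h^{p,q}=\dim H^{p,q}$ ($p+q=n$, $p,q\ge 0$), written through their Hodge filtrations $F=(F^p)$. Assume that all $h^{p,q}$ with $p+q=n$ and $p,q\geq 0$ are non-zero. Give $D$ its complex structure as an open subset of $\check D=G_{\mathbb C}/B$, where $G=\mathrm{Aut}(H,Q)$ has complexified Lie algebra $\mathscr G_{\mathbb C}$, so that $T_FD=\mathscr G_{\mathbb C}/\mathfrak b_F$ with $\mathfrak b_F=\{A\in\mathscr G_{\mathbb C}: A F^p\subseteq F^p \text{ for all } p\}$. Put $$\mathscr G_F^{-1,1}=\{A\in \mathscr G_{\mathbb C}: A(H^{p,q})\subseteq H^{p-1,q+1}\text{ for all }p+q=n\},$$ let $W_I\subseteq TD$ be the horizontal distribution whose fibre at $F$ is the image of $\mathscr G_F^{-1,1}$, and let $I=W_I^\perp\subseteq T^*D$ be the infinitesimal period relation. Then: (a) $I$ has no non-zero completely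 integrable subsystem, even locally: if $U\subseteq D$ is open and $J\subseteq I|_U$ is a holomorphic sub-bundle of $T^*U$ such that $d\theta\in J\wedge T^*U$ pointwise for every local holomorphic section $\theta$ of $J$ (Frobenius condition), then $J=0$. (b) There are no non-constant local functions that are constant on all local integral manifolds of $I$: if $U\subseteq D$ is open and connected and $f:U\to\mathbb C$ is a smooth (for example, holomorphic) function such that $f\circ\psi$ is constant for every holomorphic immersion $\psi:S\to U$ of a connected open set $S\subseteq\mathbb C^k$ ($k\ge 0$) with $\psi_*(TS)\subseteq W_I$, then $f$ is constant. -/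

import Mathlib

open scoped TensorProduct ComplexConjugate Topology ContDiff

noncomputable section

/-! ### Linear algebra over the complexification -/

/-- The complexification `H_ℂ = ℂ ⊗ H` of a rational vector space. -/
def Complexification (H : Type*) [AddCommGroup H] [Module ℚ H] : Type _ := ℂ ⊗[ℚ] H

instance (H : Type*) [AddCommGroup H] [Module ℚ H] : AddCommGroup (Complexification H) :=
  inferInstanceAs (AddCommGroup (ℂ ⊗[ℚ] H))

instance (H : Type*) [AddCommGroup H] [Module ℚ H] : Module ℂ (Complexification H) :=
  inferInstanceAs (Module ℂ (ℂ ⊗[ℚ] H))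

instance (H : Type*) [AddCommGroup H] [Module ℚ H] : Module ℚ (Complexification H) :=
  inferInstanceAs (Module ℚ (ℂ ⊗[ℚ] H))

instance (H : Type*) [AddCommGroup H] [Module ℚ H] : IsScalarTower ℚ ℂ (Complexification H) :=
  inferInstanceAs (IsScalarTower ℚ ℂ (ℂ ⊗[ℚ] H))

instance (H : Type*) [AddCommGroup H] [Module ℚ H] [FiniteDimensional ℚ H] :
    FiniteDimensional ℂ (Complexification H) :=
  inferInstanceAs (Module.Finite ℂ (ℂ ⊗[ℚ] H))

/-- Complex conjugation `z ⊗ u ↦ conj z ⊗ u` on `ℂ ⊗ H`. -/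
def tensorConj (H : Type*) [AddCommGroup H] [Module ℚ H] :
    ℂ ⊗[ℚ] H →ₛₗ[starRingEnd ℂ] ℂ ⊗[ℚ] H where
  toFun := LinearMap.rTensor H (Complex.conjAe.toLinearMap.restrictScalars ℚ)
  map_add' := map_add _
  map_smul' := by
    intro c x
    induction x using TensorProduct.induction_on with
    | zero => simp
    | tmul z u => simp [TensorProduct.smul_tmul']
    | add x y hx hy => rw [smul_add, map_add, hx, hy, map_add, smul_add]

/-- Complex conjugation on `H_ℂ`. -/
def complexConj (H : Type*) [AddCommGroup H] [Module ℚ H] :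
    Complexification H →ₛₗ[starRingEnd ℂ] Complexification H :=
  tensorConj H

/-- The complex bilinear extension of `Q` to `H_ℂ`. -/
def complexForm {H : Type*} [AddCommGroup H] [Module ℚ H] (Q : LinearMap.BilinForm ℚ H) :
    LinearMap.BilinForm ℂ (Complexification H) :=
  (LinearMap.BilinForm.baseChange ℂ Q : LinearMap.BilinForm ℂ (ℂ ⊗[ℚ] H))

/-- The complex Lie algebra `𝒢_ℂ` of `G = Aut (H, Q)`: endomorphisms `A` of `H_ℂ` with
`Q (A u, v) + Q (u, A v) = 0`. -/
def lieAlg {H : Type*} [AddCommGroup H] [Module ℚ H] (Q : LinearMap.BilinForm ℚ H) :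
    Submodule ℂ (Module.End ℂ (Complexification H)) where
  carrier := {A | ∀ u v, complexForm Q (A u) v + complexForm Q u (A v) = 0}
  zero_mem' := by intro u v; simp
  add_mem' := by
    intro A B hA hB u v
    have h1 := hA u v
    have h2 := hB u v
    simp only [LinearMap.add_apply, map_add]
    linear_combination h1 + h2
  smul_mem' := by
    intro c A hA u v
    have h1 := hA u v
    simp only [LinearMap.smul_apply, map_smul, smul_eq_mul]
    linear_combination c * h1

/-! ### The period domain -/

/-- The piece `H^{p,q} = F^p ∩ conj F^q` attached to a filtration. -/
def hodgePiece {H : Type*} [AddCommGroup H] [Module ℚ H]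
    (F : ℤ → Submodule ℂ (Complexification H)) (p q : ℤ) :
    Submodule ℂ (Complexification H) :=
  F p ⊓ (F q).map (complexConj H)

/-- The period domain: Hodge structures of weight `n` on `H`, given by their Hodge filtrations,
which are polarized by `Q` and have Hodge numbers `dim H^{p,q} = h p q`. -/
@[ext]
structure PeriodDomain {H : Type*} [AddCommGroup H] [Module ℚ H]
    (Q : LinearMap.BilinForm ℚ H) (n : ℕ) (h : ℕ → ℕ → ℕ) where
  /-- the Hodge filtration -/
  fil : ℤ → Submodule ℂ (Complexification H)
  antitone_fil : Antitone fil
  fil_zero : fil 0 = ⊤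
  /-- `F^p ⊕ conj F^{n-p+1} = H_ℂ` -/
  isCompl_fil : ∀ p : ℤ, IsCompl (fil p) ((fil (n - p + 1)).map (complexConj H))
  finrank_hodgePiece : ∀ p q : ℕ, p + q = n → Module.finrank ℂ (hodgePiece fil p q) = h p q
  /-- first bilinear relation -/
  form_eq_zero : ∀ p : ℤ, ∀ u ∈ fil p, ∀ v ∈ fil (n - p + 1), complexForm Q u v = 0
  /-- second bilinear relation `Q (C u, conj u) > 0` for `u ≠ 0`; here `u = ∑ u_p` with
  `u_p ∈ H^{p,n-p}`, and the Weil operator `C` is multiplication by `i^{p-q}` on `H^{p,q}` -/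
  form_pos : ∀ u : ℕ → Complexification H,
    (∀ p ∈ Finset.range (n + 1), u p ∈ hodgePiece fil p (n - p)) →
    (∑ p ∈ Finset.range (n + 1), u p) ≠ 0 →
      let z : ℂ := complexForm Q
        (∑ p ∈ Finset.range (n + 1), Complex.I ^ ((p : ℤ) - ((n : ℤ) - p)) • u p)
        (complexConj H (∑ p ∈ Finset.range (n + 1), u p))
      0 < z.re ∧ z.im = 0

namespace PeriodDomain

variable {H : Type*} [AddCommGroup H] [Module ℚ H] {Q : LinearMap.BilinForm ℚ H} {n : ℕ}
  {h : ℕ → ℕ → ℕ}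

/-- The Hodge component `𝒢^{r,-r}` of `𝒢_ℂ` at `F`: those `A` that map `H^{p,q}` into
`H^{p+r,q-r}` for all `p + q = n`. -/
def gr (F : PeriodDomain Q n h) (r : ℤ) : Submodule ℂ (lieAlg Q) where
  carrier := {A | ∀ p q : ℤ, p + q = n → ∀ u ∈ hodgePiece F.fil p q,
    A.1 u ∈ hodgePiece F.fil (p + r) (q - r)}
  zero_mem' := by intro p q _ u _; simp
  add_mem' := by
    intro A B hA hB p q hpq u hu
    exact add_mem (hA p q hpq u hu) (hB p q hpq u hu)
  smul_mem' := by
    intro c A hA p q hpq u hu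
    exact Submodule.smul_mem _ c (hA p q hpq u hu)

/-- The Lie algebra `𝔟` of the stabilizer `B ⊆ G_ℂ` of the filtration `F`. -/
def stab (F : PeriodDomain Q n h) : Submodule ℂ (lieAlg Q) where
  carrier := {A | ∀ p : ℤ, ∀ u ∈ F.fil p, A.1 u ∈ F.fil p}
  zero_mem' := by intro p u _; simp
  add_mem' := by
    intro A B hA hB p u hu
    exact add_mem (hA p u hu) (hB p u hu)
  smul_mem' := by
    intro c A hA p u hu
    exact Submodule.smul_mem _ c (hA p u hu)

/-- The complement `𝔭 = ⊕_{r > 0} 𝒢^{-r,r}` of `𝔟` in `𝒢_ℂ`, as a space of endomorphisms. -/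
def compl (F : PeriodDomain Q n h) : Submodule ℂ (Module.End ℂ (Complexification H)) :=
  ⨆ r : {r : ℤ // 0 < r}, (F.gr (-r.1)).map (lieAlg Q).subtype

/-- The holomorphic tangent space `T_F D = 𝒢_ℂ / 𝔟`, the tangent space of `G_ℂ / B` at `F`. -/
abbrev Tangent (F : PeriodDomain Q n h) : Type _ := lieAlg Q ⧸ F.stab

/-- The horizontal distribution `W_I ⊆ T D`: the image of `𝒢^{-1,1}`. -/
def horizontal (F : PeriodDomain Q n h) : Submodule ℂ F.Tangent :=
  (F.gr (-1)).map F.stab.mkQ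

/-- The infinitesimal period relation `I = W_I^⊥ ⊆ T^* D`. -/
def periodRelation (F : PeriodDomain Q n h) : Submodule ℂ (Module.Dual ℂ F.Tangent) :=
  F.horizontal.dualAnnihilator

/-! ### The complex manifold structure -/

/-- The number of local coordinates at `F`, the dimension of `𝔭`. -/
abbrev dim (F : PeriodDomain Q n h) : ℕ := Module.finrank ℂ F.compl

/-- Linear coordinates on `𝔭`. -/
def coord [FiniteDimensional ℚ H] (F : PeriodDomain Q n h) (x : Fin F.dim → ℂ) :
    Module.End ℂ (Complexification H) :=
  ((Module.finBasis ℂ F.compl).equivFun.symm x : F.compl).1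

open Classical in
/-- The local holomorphic parametrization `𝔭 → D`, `A ↦ exp A · F`, of a neighbourhood of `F`,
written in linear coordinates on `𝔭`; `0` corresponds to `F`. The elements of `𝔭` are nilpotent.
The filtration `exp A · F` lies in `D` for `A` near `0`; where it does not, the value is
irrelevant, and is set to `F`. -/
def chart [FiniteDimensional ℚ H] (F : PeriodDomain Q n h) (x : Fin F.dim → ℂ) :
    PeriodDomain Q n h :=
  if hx : ∃ F' : PeriodDomain Q n h, ∀ p, F'.fil p = (F.fil p).map (IsNilpotent.exp (F.coord x))
  then hx.choose else F

/-- The manifold topology of `D`: a set is open if it contains, with each of its points `F`, the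
image of a neighbourhood of `0` under the local parametrization at `F`. -/
instance [FiniteDimensional ℚ H] : TopologicalSpace (PeriodDomain Q n h) where
  IsOpen U := ∀ F ∈ U, ∀ᶠ x in 𝓝 (0 : Fin F.dim → ℂ), F.chart x ∈ U
  isOpen_univ := by intro F _; simp
  isOpen_inter := by
    intro U V hU hV F hF
    exact (hU F hF.1).and (hV F hF.2)
  isOpen_sUnion := by
    intro 𝒰 h𝒰 F hF
    obtain ⟨U, hU, hFU⟩ := hF
    exact (h𝒰 U hU F hFU).mono fun x hx => ⟨U, hU, hx⟩

/-- `φ` is holomorphic at `v` with differential `L : ℂ^k → T_{φ(v)} D = 𝒢_ℂ / 𝔟`: near `v` we have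
`φ(w) = g(w) · φ(v)` for a holomorphic `g` with values in `G_ℂ` and `g(v) = 1`, and `L ξ` is the
class of the derivative `∂_ξ g (v) ∈ 𝒢_ℂ`. (Holomorphy and derivatives of `g` are taken entrywise.)
-/
def HasDifferentialAt {k : ℕ} (φ : (Fin k → ℂ) → PeriodDomain Q n h) (v : Fin k → ℂ)
    (L : (Fin k → ℂ) →ₗ[ℂ] (φ v).Tangent) : Prop :=
  ∃ g : (Fin k → ℂ) → Module.End ℂ (Complexification H),
    (∀ (u : Complexification H) (l : Module.Dual ℂ (Complexification H)),
      AnalyticAt ℂ (fun w => l (g w u)) v) ∧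
    g v = 1 ∧
    (∀ᶠ w in 𝓝 v, (∀ u u', complexForm Q (g w u) (g w u') = complexForm Q u u') ∧
      ∀ p, (φ w).fil p = ((φ v).fil p).map (g w)) ∧
    ∀ ξ : Fin k → ℂ, ∃ A : lieAlg Q, L ξ = (φ v).stab.mkQ A ∧
      ∀ (u : Complexification H) (l : Module.Dual ℂ (Complexification H)),
        fderiv ℂ (fun w => l (g w u)) v ξ = l (A.1 u)

/-- Holomorphy at a point of a map from `ℂ^k` to `D`. -/
def IsHolomorphicAt {k : ℕ} (φ : (Fin k → ℂ) → PeriodDomain Q n h) (v : Fin k → ℂ) : Prop :=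
  ∃ L, HasDifferentialAt φ v L

open Classical in
/-- The differential of a holomorphic map to `D`; it does not depend on the choice of the lift `g`
in `HasDifferentialAt`. -/
def differential {k : ℕ} (φ : (Fin k → ℂ) → PeriodDomain Q n h) (v : Fin k → ℂ) :
    (Fin k → ℂ) →ₗ[ℂ] (φ v).Tangent :=
  if hφ : IsHolomorphicAt φ v then hφ.choose else 0

/-- Complex-valued functions which are smooth (`C^∞` in the real sense) on `U`, in the local
coordinates at each point. -/
def IsSmoothOn [FiniteDimensional ℚ H] (f : PeriodDomain Q n h → ℂ)
    (U : Set (PeriodDomain Q n h)) : Prop :=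
  ∀ F ∈ U, ContDiffAt ℝ ∞ (fun x => f (F.chart x)) 0

/-! ### Pfaffian systems and integral manifolds -/

/-- The pullback to `T_v^* ℂ^k` under `φ` of a family `J` of subspaces of the fibres of `T^* D`. -/
def pullback {k : ℕ} (J : ∀ F : PeriodDomain Q n h, Submodule ℂ (Module.Dual ℂ F.Tangent))
    (φ : (Fin k → ℂ) → PeriodDomain Q n h) (v : Fin k → ℂ) :
    Submodule ℂ ((Fin k → ℂ) →L[ℂ] ℂ) :=
  ((J (φ v)).map (differential φ v).dualMap).map
    (LinearMap.toContinuousLinearMap : ((Fin k → ℂ) →ₗ[ℂ] ℂ) ≃ₗ[ℂ] _).toLinearMap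

/-- `J` is a Pfaffian system on `U`, that is, a holomorphic sub-bundle of `T^* U`: in the local
coordinates at each point of `U` it has a holomorphic frame near that point. -/
def IsPfaffianSystemOn [FiniteDimensional ℚ H]
    (J : ∀ F : PeriodDomain Q n h, Submodule ℂ (Module.Dual ℂ F.Tangent))
    (U : Set (PeriodDomain Q n h)) : Prop :=
  ∀ F ∈ U, ∃ (r : ℕ) (θ : Fin r → (Fin F.dim → ℂ) → ((Fin F.dim → ℂ) →L[ℂ] ℂ)),
    (∀ i, AnalyticAt ℂ (θ i) 0) ∧
    ∀ᶠ x in 𝓝 (0 : Fin F.dim → ℂ), LinearIndependent ℂ (fun i => θ i x) ∧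
      Submodule.span ℂ (Set.range fun i => θ i x) = pullback J F.chart x

/-- The exterior derivative of a `1`-form:
`dθ_x (ξ, η) = (∂_ξ θ)(η) - (∂_η θ)(ξ)`. -/
def extDerivOneForm {N : ℕ} (θ : (Fin N → ℂ) → ((Fin N → ℂ) →L[ℂ] ℂ)) (x : Fin N → ℂ) :
    (Fin N → ℂ) →L[ℂ] (Fin N → ℂ) →L[ℂ] ℂ :=
  fderiv ℂ θ x - (fderiv ℂ θ x).flip

/-- The wedge product `(α ∧ β)(ξ, η) = α(ξ) β(η) - β(ξ) α(η)`. -/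
def wedge {N : ℕ} (α β : (Fin N → ℂ) →L[ℂ] ℂ) :
    (Fin N → ℂ) →L[ℂ] (Fin N → ℂ) →L[ℂ] ℂ :=
  α.smulRight β - β.smulRight α

/-- `J` is completely integrable (Frobenius) on `U`: `dθ ∈ J ∧ T^*` for all local holomorphic
sections `θ` of `J`, in the local coordinates at each point of `U`. -/
def IsCompletelyIntegrableOn [FiniteDimensional ℚ H]
    (J : ∀ F : PeriodDomain Q n h, Submodule ℂ (Module.Dual ℂ F.Tangent))
    (U : Set (PeriodDomain Q n h)) : Prop :=
  ∀ F ∈ U, ∀ θ : (Fin F.dim → ℂ) → ((Fin F.dim → ℂ) →L[ℂ] ℂ), AnalyticAt ℂ θ 0 →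
    (∀ᶠ x in 𝓝 0, θ x ∈ pullback J F.chart x) →
    ∀ᶠ x in 𝓝 0, extDerivOneForm θ x ∈
      Submodule.span ℂ {η | ∃ α ∈ pullback J F.chart x, ∃ β, η = wedge α β}

/-- `ψ : S → D` is a local integral manifold of `I`: a holomorphic immersion of an open set
`S ⊆ ℂ^k` with `ψ_* (T S) ⊆ W_I`. -/
def IsIntegralManifold {k : ℕ} (S : Set (Fin k → ℂ))
    (ψ : (Fin k → ℂ) → PeriodDomain Q n h) : Prop :=
  IsOpen S ∧ ∀ v ∈ S, IsHolomorphicAt ψ v ∧ Function.Injective (differential ψ v) ∧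
    LinearMap.range (differential ψ v) ≤ (ψ v).horizontal

end PeriodDomain

end

/-! Everything is lifted from a neighbourhood of `F` in `D` to a neighbourhood of `1` in the vector
space `End H_ℂ`, where `G_ℂ` is the locus `σ g * g = 1`, with `σ` the adjoint for `Q`. A map `C`
with `chart (C g) = g F` for `g ∈ G_ℂ` near `1` turns forms and functions on `D` into forms and
functions of `g`. The left invariant fields `g ↦ g X` with `X ∈ 𝒢^{-1,1}` project to horizontal
vectors, because `g X g⁻¹` shifts the filtration `g F` by at most one.

For (a), sections of `J` pull back to forms annihilating the fields `g X`. If such forms also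
annihilate `g A`, Cartan's formula together with the Frobenius condition shows that they annihilate
`g [X, A]` (`eventually_form_commutator_eq_zero`). Since `𝒢^{-1,1}` generates `𝔭 = ⊕_{r>0} 𝒢^{-r,r}`
(`compl_le_of_bracket_closed`), they annihilate every `g A` with `A ∈ 𝔭`. At `g = 1` these vectors
fill `T_F D`, so `J` vanishes at `F`.

For (b), the curves `t ↦ g exp(tX) F` with `X ≠ 0` in `𝒢^{-1,1}` are integral manifolds, so `df`
annihilates the fields `g X`. The same bracket argument applies, `df` being closed, and `f` is
constant along the rays `exp(tA) F`, `A ∈ 𝔭`.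

Generation is where the Hodge numbers matter. `𝒢_ℂ` is spanned by the operators `skewEnd u v`, which
have degree `a + b - n` if `u ∈ H^{a,n-a}` and `v ∈ H^{b,n-b}`. When `a + b ≤ n - 2`, after
exchanging `u` and `v` if necessary, one finds `X ∈ 𝒢^{-1,1}` and `u' ∈ H^{a+1,n-a-1}` with `X u' =
u` and `X v = 0`. Then `skewEnd u v = [X, skewEnd u' v]`, and induction on the degree finishes. -/

noncomputable section

/-! ### Banach algebras with an anti-automorphism -/

section BanachAlgebra

variable {E : Type*} [NormedRing E] [NormedAlgebra ℂ E] [CompleteSpace E]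

theorem exp_mul_exp_neg (a : E) : NormedSpace.exp a * NormedSpace.exp (-a) = 1 := by
  let := NormedAlgebra.restrictScalars ℚ ℂ E
  rw [← NormedSpace.exp_add_of_commute (Commute.neg_right (Commute.refl a)), add_neg_cancel,
    NormedSpace.exp_zero]

theorem exp_neg_mul_exp (a : E) : NormedSpace.exp (-a) * NormedSpace.exp a = 1 := by
  simpa using exp_mul_exp_neg (-a)

theorem exp_add_smul (s t : ℂ) (a : E) :
    NormedSpace.exp ((s + t) • a) = NormedSpace.exp (s • a) * NormedSpace.exp (t • a) := by
  let := NormedAlgebra.restrictScalars ℚ ℂ E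
  rw [add_smul, NormedSpace.exp_add_of_commute
    (((Commute.refl a).smul_left s).smul_right t)]

theorem continuous_exp_banach : Continuous (NormedSpace.exp : E → E) := by
  let := NormedAlgebra.restrictScalars ℚ ℂ E
  exact NormedSpace.exp_continuous

/-- Reversing the order of factors is invisible on powers of one element, so `σ` passes through the
exponential series term by term. -/
theorem map_exp_of_antimultiplicative (σ : E →L[ℂ] E) (hσ : ∀ a b, σ (a * b) = σ b * σ a)
    (hσ1 : σ 1 = 1) (a : E) : σ (NormedSpace.exp a) = NormedSpace.exp (σ a) := by
  have hpow : ∀ k : ℕ, σ (a ^ k) = σ a ^ k := by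
    intro k
    induction k with
    | zero => simp [hσ1]
    | succ k ih => rw [pow_succ, hσ, ih, pow_succ']
  rw [NormedSpace.exp_eq_tsum ℂ]
  simp only
  rw [ContinuousLinearMap.map_tsum _ (NormedSpace.expSeries_summable' (𝕂 := ℂ) a)]
  simp [hpow]

/-- Triangular decomposition near `1`: the map `M ↦ exp (π M) * exp (M - π M)` is a local
isomorphism at `0`, and the first component of its inverse is compatible with the group
`σ g * g = 1`. -/
theorem exists_local_triangular_decomposition (π σ : E →L[ℂ] E) (hπ : ∀ a, π (π a) = π a)
    (hσ : ∀ a b, σ (a * b) = σ b * σ a) (hσ1 : σ 1 = 1) (hπσ : ∀ a, π (σ a) = σ (π a)) :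
    ∃ c : E → E, ContDiffAt ℂ ω c 1 ∧ c 1 = 0 ∧
      (∀ᶠ g in 𝓝 1, π (c g) = c g ∧
        ∃ b, π b = 0 ∧ g = NormedSpace.exp (c g) * NormedSpace.exp b ∧
          (σ g * g = 1 → σ (c g) = -c g)) ∧
      ∀ᶠ m in 𝓝 0, π m = m → c (NormedSpace.exp m) = m := by
  set Φ : E → E := fun M => NormedSpace.exp (π M) * NormedSpace.exp (M - π M) with hΦ
  have hΦ0 : Φ 0 = 1 := by simp [hΦ]
  have hexp : ContDiff ℂ ω (NormedSpace.exp : E → E) :=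
    contDiff_iff_contDiffAt.2 fun x => (NormedSpace.exp_analytic (𝕂 := ℂ) x).contDiffAt
  have hΦc : ContDiff ℂ ω Φ :=
    (hexp.comp π.contDiff).mul (hexp.comp (contDiff_id.sub π.contDiff))
  -- The two factors contribute `π` and `1 - π`, so the derivative at `0` is the identity and the
  -- inverse function theorem applies.
  have hΦd : HasFDerivAt Φ ((ContinuousLinearEquiv.refl ℂ E : E ≃L[ℂ] E) : E →L[ℂ] E) 0 := by
    have h0 : HasFDerivAt (NormedSpace.exp : E → E) (1 : E →L[ℂ] E) (π 0) := by
      rw [map_zero]; exact hasFDerivAt_exp_zero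
    have h0' : HasFDerivAt (NormedSpace.exp : E → E) (1 : E →L[ℂ] E)
        ((ContinuousLinearMap.id ℂ E - π) 0) := by
      rw [map_zero]; exact hasFDerivAt_exp_zero
    have h1 := h0.comp (0 : E) π.hasFDerivAt
    have h2 := h0'.comp (0 : E) (ContinuousLinearMap.id ℂ E - π).hasFDerivAt
    refine (h1.mul' h2).congr_fderiv ?_
    ext v
    simp
  set e := (hΦc.contDiffAt (x := 0)).toOpenPartialHomeomorph Φ hΦd (by simp) with he
  have hcoe : ∀ x, e x = Φ x := fun x => rfl
  have h0s : (0 : E) ∈ e.source := ContDiffAt.mem_toOpenPartialHomeomorph_source _ _ _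
  have h1t : (1 : E) ∈ e.target := by
    rw [← hΦ0]; exact ContDiffAt.image_mem_toOpenPartialHomeomorph_target _ _ _
  have hinv1 : e.symm 1 = 0 := by
    rw [← hΦ0, ← hcoe]; exact e.left_inv h0s
  have hΨc : ContDiffAt ℂ ω e.symm 1 := by
    rw [← hΦ0]
    exact ContDiffAt.to_localInverse (hΦc.contDiffAt (x := 0)) hΦd (by simp)
  refine ⟨fun g => π (e.symm g), π.contDiff.contDiffAt.comp _ hΨc, by simp [hinv1], ?_, ?_⟩
  · have ht : ∀ᶠ g in 𝓝 (1 : E), g ∈ e.target := e.open_target.mem_nhds h1t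
    have hs : ∀ᶠ g in 𝓝 (1 : E), -σ (e.symm g) ∈ e.source := by
      have hc : ContinuousAt (fun g => -σ (e.symm g)) 1 :=
        (σ.continuous.continuousAt.comp hΨc.continuousAt).neg
      refine hc.eventually_mem (e.open_source.mem_nhds ?_)
      simpa [hinv1] using h0s
    filter_upwards [ht, hs] with g hgt hgs
    have hg : Φ (e.symm g) = g := e.right_inv hgt
    refine ⟨hπ _, e.symm g - π (e.symm g), by simp [hπ], hg.symm, fun hG => ?_⟩
    set M := e.symm g with hM
    -- On the group, `σ g` is a left and right inverse of `g`. Applying `σ` to the factorization of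
    -- `g` and inverting gives a factorization of the same shape, so `-σ M` is a second preimage of
    -- `g`; local injectivity then forces `σ M = -M`.
    have hk : Φ (-σ M) = g := by
      have h1 : σ g = NormedSpace.exp (σ M - σ (π M)) * NormedSpace.exp (σ (π M)) := by
        rw [← hg, hΦ]
        simp only
        rw [hσ, map_exp_of_antimultiplicative σ hσ hσ1, map_exp_of_antimultiplicative σ hσ hσ1,
          map_sub]
      have h2 : Φ (-σ M) = NormedSpace.exp (-σ (π M)) * NormedSpace.exp (-(σ M - σ (π M))) := by
        rw [hΦ]
        simp only [map_neg, hπσ]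
        congr 2
        abel
      have h3 : Φ (-σ M) * σ g = 1 := by
        rw [h1, h2, mul_assoc, ← mul_assoc (NormedSpace.exp (-(σ M - σ (π M)))), exp_neg_mul_exp,
          one_mul, exp_neg_mul_exp]
      calc Φ (-σ M) = Φ (-σ M) * (σ g * g) := by rw [hG, mul_one]
        _ = g := by rw [← mul_assoc, h3, one_mul]
    have hMM : -σ M = M := e.injOn hgs (e.map_target hgt) (by rw [hcoe, hcoe, hk, hg])
    have hσM : σ M = -M := neg_eq_iff_eq_neg.1 hMM
    rw [← hπσ, hσM, map_neg]
  · filter_upwards [e.open_source.mem_nhds h0s] with m hm hmπ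
    have : NormedSpace.exp m = e m := by rw [hcoe, hΦ]; simp [hmπ]
    rw [this, e.left_inv hm, hmπ]

end BanachAlgebra

/-! ### The bracket argument for forms on a matrix group -/

/-- If a family of `1`-forms `Ω i` vanishes at the points of the group `σ g * g = 1` near `1` on
the left invariant fields of `X` and `A`, and `dΩ` vanishes on these fields, then the forms vanish
on the left invariant field of `[X, A]`. -/
theorem eventually_form_commutator_eq_zero {E : Type*} [NormedRing E]
    [CompleteSpace E] {𝕜 : Type*} [RCLike 𝕜] [NormedAlgebra 𝕜 E]
    {Y : Type*} [NormedAddCommGroup Y] [NormedSpace 𝕜 Y] {ι : Type*} [Finite ι] (S : Set E)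
    (X A : E) (hSX : ∀ g ∈ S, ∀ t : 𝕜, g * NormedSpace.exp (t • X) ∈ S)
    (hSA : ∀ g ∈ S, ∀ t : 𝕜, g * NormedSpace.exp (t • A) ∈ S)
    (Ω : ι → E → E →L[𝕜] Y) (hΩ : ∀ᶠ g in 𝓝 1, ∀ i, DifferentiableAt 𝕜 (Ω i) g)
    (hX : ∀ᶠ g in 𝓝 1, g ∈ S → ∀ i, Ω i g (g * X) = 0)
    (hA : ∀ᶠ g in 𝓝 1, g ∈ S → ∀ i, Ω i g (g * A) = 0)
    (hd : ∀ᶠ g in 𝓝 1, g ∈ S → (∀ i, Ω i g (g * X) = 0) → (∀ i, Ω i g (g * A) = 0) →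
      ∀ i, fderiv 𝕜 (Ω i) g (g * X) (g * A) = fderiv 𝕜 (Ω i) g (g * A) (g * X)) :
    ∀ᶠ g in 𝓝 1, g ∈ S → ∀ i, Ω i g (g * (X * A - A * X)) = 0 := by
  -- Differentiate `Ω_g (g C) = 0` along the curve `g exp(tB)`. The curve stays in `S`, so `S` need
  -- not be given a manifold structure.
  have key : ∀ (B C : E), (∀ g ∈ S, ∀ t : 𝕜, g * NormedSpace.exp (t • B) ∈ S) →
      ∀ g ∈ S, (∀ᶠ g' in 𝓝 g, g' ∈ S → ∀ i, Ω i g' (g' * C) = 0) →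
      ∀ i, DifferentiableAt 𝕜 (Ω i) g →
        fderiv 𝕜 (Ω i) g (g * B) (g * C) + Ω i g (g * B * C) = 0 := by
    intro B C hB g hg hev i hdiff
    have hcurve : HasDerivAt (fun t : 𝕜 => g * NormedSpace.exp (t • B)) (g * B) 0 := by
      simpa using (hasDerivAt_exp_smul_const B (0 : 𝕜)).const_mul g
    have h0 : g * NormedSpace.exp ((0 : 𝕜) • B) = g := by simp
    have hdiff' : HasFDerivAt (Ω i) (fderiv 𝕜 (Ω i) g)
        ((fun t : 𝕜 => g * NormedSpace.exp (t • B)) 0) := by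
      simpa using hdiff.hasFDerivAt
    have h1 : HasDerivAt (fun t : 𝕜 => Ω i (g * NormedSpace.exp (t • B)))
        (fderiv 𝕜 (Ω i) g (g * B)) 0 := hdiff'.comp_hasDerivAt (0 : 𝕜) hcurve
    have h2 := h1.clm_apply (hcurve.mul_const C)
    have h3 : (fun t : 𝕜 => Ω i (g * NormedSpace.exp (t • B)) (g * NormedSpace.exp (t • B) * C))
        =ᶠ[𝓝 0] fun _ => 0 := by
      have hc : ContinuousAt (fun t : 𝕜 => g * NormedSpace.exp (t • B)) 0 := hcurve.continuousAt
      have := hc.eventually (p := fun g' => g' ∈ S → ∀ i, Ω i g' (g' * C) = 0)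
        (by simpa using hev)
      filter_upwards [this] with t ht
      exact ht (hB g hg t) i
    have h4 := h2.unique ((hasDerivAt_const (0 : 𝕜) (0 : Y)).congr_of_eventuallyEq h3)
    simpa using h4
  filter_upwards [hΩ, hX.eventually_nhds, hA.eventually_nhds, hd] with g hΩ hX hA hd hg i
  -- The two identities have the same first term by `hd`; their difference is `Ω (g (X A - A X)) =
  -- 0`.
  have h1 := key X A hSX g hg hA i (hΩ i)
  have h2 := key A X hSA g hg hX i (hΩ i)
  have h3 := hd hg (hX.self_of_nhds hg) (hA.self_of_nhds hg) i
  rw [h3] at h1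
  rw [mul_sub, map_sub, ← mul_assoc, ← mul_assoc, sub_eq_zero]
  exact add_left_cancel (h1.trans h2.symm)

/-- A conjugate linear map between finite dimensional complex spaces is continuous. -/
theorem continuous_of_conjLinear {E E' : Type*} [NormedAddCommGroup E] [NormedSpace ℂ E]
    [FiniteDimensional ℂ E] [NormedAddCommGroup E'] [NormedSpace ℂ E']
    (f : E →ₛₗ[starRingEnd ℂ] E') : Continuous f := by
  have : FiniteDimensional ℝ E := FiniteDimensional.complexToReal E
  let f' : E →ₗ[ℝ] E' :=
    { toFun := f
      map_add' := map_add f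
      map_smul' := by
        intro r x
        have h1 : r • x = (r : ℂ) • x := rfl
        have h2 : r • f x = (r : ℂ) • f x := rfl
        rw [h1, RingHom.id_apply, h2, f.map_smulₛₗ, Complex.conj_ofReal] }
  exact f'.continuous_of_finiteDimensional

/-! ### The complexified form and conjugation -/

section Complexification

variable {H : Type*} [AddCommGroup H] [Module ℚ H]

/-- The element `z ⊗ x` of `H_ℂ`. -/
def Complexification.tmul (z : ℂ) (x : H) : Complexification H :=
  (z ⊗ₜ[ℚ] x : ℂ ⊗[ℚ] H)

theorem Complexification.induction {motive : Complexification H → Prop} (u : Complexification H)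
    (zero : motive 0) (tmul : ∀ (z : ℂ) (x : H), motive (tmul z x))
    (add : ∀ u v, motive u → motive v → motive (u + v)) : motive u :=
  TensorProduct.induction_on (motive := motive) u zero tmul add

theorem complexForm_tmul (Q : LinearMap.BilinForm ℚ H) (z w : ℂ) (x y : H) :
    complexForm Q (.tmul z x) (.tmul w y) = (Q x y : ℂ) * (z * w) := by
  have := LinearMap.BilinForm.baseChange_tmul (A := ℂ) (B₂ := Q) z x w y
  refine this.trans ?_
  rw [Rat.smul_def]

theorem complexConj_tmul (z : ℂ) (x : H) :
    complexConj H (.tmul z x) = .tmul (starRingEnd ℂ z) x := rfl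

@[simp]
theorem complexConj_complexConj (u : Complexification H) : complexConj H (complexConj H u) = u := by
  induction u using Complexification.induction with
  | zero => simp
  | tmul z x => rw [complexConj_tmul, complexConj_tmul, Complex.conj_conj]
  | add u v hu hv => rw [map_add, map_add, hu, hv]

theorem complexForm_conj (Q : LinearMap.BilinForm ℚ H) (u v : Complexification H) :
    complexForm Q (complexConj H u) (complexConj H v) = starRingEnd ℂ (complexForm Q u v) := by
  induction u using Complexification.induction with
  | zero => simp
  | add u u' hu hu' => simp only [map_add, LinearMap.add_apply, hu, hu']
  | tmul z x =>
    induction v using Complexification.induction with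
    | zero => simp
    | add v v' hv hv' => simp only [map_add, hv, hv']
    | tmul w y => simp [complexConj_tmul, complexForm_tmul]

theorem complexForm_symm (Q : LinearMap.BilinForm ℚ H) (n : ℕ)
    (hQ : ∀ u v, Q u v = (-1) ^ n * Q v u) (u v : Complexification H) :
    complexForm Q u v = (-1) ^ n * complexForm Q v u := by
  induction u using Complexification.induction with
  | zero => simp
  | add u u' hu hu' => simp only [map_add, LinearMap.add_apply, hu, hu', mul_add]
  | tmul z x =>
    induction v using Complexification.induction with
    | zero => simp
    | add v v' hv hv' => simp only [map_add, LinearMap.add_apply, hv, hv', mul_add]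
    | tmul w y =>
      rw [complexForm_tmul, complexForm_tmul, hQ x y]
      push_cast
      ring

theorem complexForm_nondegenerate [FiniteDimensional ℚ H] {Q : LinearMap.BilinForm ℚ H}
    (hQ : Q.Nondegenerate) : (complexForm Q).Nondegenerate := by
  classical
  let b := Module.finBasis ℚ H
  let b' : Module.Basis _ ℂ (Complexification H) := Algebra.TensorProduct.basis ℂ b
  rw [LinearMap.BilinForm.nondegenerate_iff_det_ne_zero b']
  have h1 := (LinearMap.BilinForm.nondegenerate_iff_det_ne_zero b).1 hQ
  have h2 : LinearMap.BilinForm.toMatrix b' (complexForm Q)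
      = (LinearMap.BilinForm.toMatrix b Q).map (algebraMap ℚ ℂ) := by
    ext i j
    rw [LinearMap.BilinForm.toMatrix_apply, Matrix.map_apply, LinearMap.BilinForm.toMatrix_apply]
    have e : ∀ i, b' i = .tmul 1 (b i) := fun i =>
      Algebra.TensorProduct.basis_apply b i
    rw [e, e, complexForm_tmul]
    simp
  rw [h2, ← RingHom.mapMatrix_apply, ← RingHom.map_det]
  simpa using h1

end Complexification

/-! ### The adjoint with respect to a nondegenerate form -/

section Adjoint

variable {K V : Type*} [Field K] [AddCommGroup V] [Module K V] [FiniteDimensional K V]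

/-- The adjoint `σ A` of `A` with respect to a nondegenerate form `B`:
`B (σ A u) v = B u (A v)`. -/
def formAdjoint (B : LinearMap.BilinForm K V) (hB : B.Nondegenerate) :
    Module.End K V →ₗ[K] Module.End K V where
  toFun A := (B.toDual hB).symm.toLinearMap ∘ₗ A.dualMap ∘ₗ (B.toDual hB).toLinearMap
  map_add' A A' := by ext u; simp [LinearMap.dualMap, Module.Dual.transpose]
  map_smul' c A := by ext u; simp [LinearMap.dualMap, Module.Dual.transpose]

variable {B : LinearMap.BilinForm K V} (hB : B.Nondegenerate)

theorem form_formAdjoint_left (A : Module.End K V) (u v : V) :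
    B (formAdjoint B hB A u) v = B u (A v) := by
  simp [formAdjoint, LinearMap.BilinForm.toDual_def]

theorem eq_of_form_left_eq (hB : B.Nondegenerate) {u u' : V} (h : ∀ v, B u v = B u' v) : u = u' :=
  (B.toDual hB).injective (LinearMap.ext h)

theorem formAdjoint_eq_of_form_eq {A A' : Module.End K V} (h : ∀ u v, B (A' u) v = B u (A v)) :
    formAdjoint B hB A = A' :=
  LinearMap.ext fun u => eq_of_form_left_eq hB fun v => by rw [form_formAdjoint_left, h]

theorem formAdjoint_mul (A A' : Module.End K V) :
    formAdjoint B hB (A * A') = formAdjoint B hB A' * formAdjoint B hB A :=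
  formAdjoint_eq_of_form_eq hB fun u v => by
    simp only [Module.End.mul_apply, form_formAdjoint_left]

theorem formAdjoint_one : formAdjoint B hB 1 = 1 :=
  formAdjoint_eq_of_form_eq hB fun u v => by simp

/-- This puts `G_ℂ` in the form `σ g * g = 1` that the triangular decomposition handles; below, the
adjoint serves as the inverse on `G_ℂ`. -/
theorem formAdjoint_mul_self_eq_one_iff {g : Module.End K V} :
    formAdjoint B hB g * g = 1 ↔ ∀ u v, B (g u) (g v) = B u v := by
  constructor
  · intro h u v
    have h' : g * formAdjoint B hB g = 1 := mul_eq_one_comm.1 h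
    rw [← form_formAdjoint_left hB, ← Module.End.mul_apply, h, Module.End.one_apply]
  · intro h
    refine LinearMap.ext fun u => eq_of_form_left_eq hB fun v => ?_
    rw [Module.End.mul_apply, form_formAdjoint_left, h, Module.End.one_apply]

theorem formAdjoint_eq_neg_iff {A : Module.End K V} :
    formAdjoint B hB A = -A ↔ ∀ u v, B (A u) v + B u (A v) = 0 := by
  constructor
  · intro h u v
    rw [← form_formAdjoint_left hB, h]
    simp
  · intro h
    refine formAdjoint_eq_of_form_eq hB fun u v => ?_
    simpa using (neg_eq_of_add_eq_zero_right (h u v))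

end Adjoint

/-! ### The Hodge decomposition -/

namespace PeriodDomain

variable {H : Type*} [AddCommGroup H] [Module ℚ H] {Q : LinearMap.BilinForm ℚ H} {n : ℕ}
  {h : ℕ → ℕ → ℕ}

/-- The projection onto `F^p` along `conj F^{n-p+1}`. -/
def filProj (F : PeriodDomain Q n h) (p : ℤ) : Module.End ℂ (Complexification H) :=
  (F.fil p).projection _ (F.isCompl_fil p)

/-- The projection onto `H^{p,n-p}` given by the Hodge decomposition. -/
def pieceProj (F : PeriodDomain Q n h) (p : ℤ) : Module.End ℂ (Complexification H) :=
  F.filProj p - F.filProj (p + 1)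

variable (F : PeriodDomain Q n h)

theorem filProj_mem (p : ℤ) (u : Complexification H) : F.filProj p u ∈ F.fil p :=
  Submodule.projection_apply_mem _ _

theorem filProj_eq_self_iff {p : ℤ} {u : Complexification H} :
    F.filProj p u = u ↔ u ∈ F.fil p :=
  ⟨fun hu => hu ▸ F.filProj_mem p u, fun hu => Submodule.projection_apply_of_mem_left _ hu⟩

theorem filProj_eq_zero_iff {p : ℤ} {u : Complexification H} :
    F.filProj p u = 0 ↔ u ∈ (F.fil (n - p + 1)).map (complexConj H) :=
  Submodule.projection_apply_eq_zero_iff _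

theorem sub_filProj_mem (p : ℤ) (u : Complexification H) :
    u - F.filProj p u ∈ (F.fil (n - p + 1)).map (complexConj H) := by
  rw [← filProj_eq_zero_iff, map_sub, F.filProj_eq_self_iff.2 (F.filProj_mem p u), sub_self]

theorem filProj_mul_of_le {p q : ℤ} (hpq : p ≤ q) : F.filProj p * F.filProj q = F.filProj q :=
  LinearMap.ext fun u => F.filProj_eq_self_iff.2 (F.antitone_fil hpq (F.filProj_mem q u))

/-- The kernels `conj F^{n-p+1}` grow with `p`, so what `filProj p` kills is also killed by `filProj
q`. -/
theorem filProj_mul_of_ge {p q : ℤ} (hpq : p ≤ q) : F.filProj q * F.filProj p = F.filProj q := by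
  refine LinearMap.ext fun u => ?_
  have h1 : F.filProj q (u - F.filProj p u) = 0 := F.filProj_eq_zero_iff.2
    (Submodule.map_mono (F.antitone_fil (by omega)) (F.sub_filProj_mem p u))
  rw [map_sub, sub_eq_zero] at h1
  exact h1.symm

theorem filProj_mul (p q : ℤ) : F.filProj p * F.filProj q = F.filProj (max p q) := by
  rcases le_total p q with hpq | hpq
  · rw [max_eq_right hpq, F.filProj_mul_of_le hpq]
  · rw [max_eq_left hpq, F.filProj_mul_of_ge hpq]

theorem filProj_of_nonpos {p : ℤ} (hp : p ≤ 0) : F.filProj p = 1 :=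
  LinearMap.ext fun u => F.filProj_eq_self_iff.2
    (F.antitone_fil hp (by rw [F.fil_zero]; trivial))

theorem fil_of_nonpos {p : ℤ} (hp : p ≤ 0) : F.fil p = ⊤ :=
  top_le_iff.1 (F.fil_zero ▸ F.antitone_fil hp)

theorem filProj_of_gt {p : ℤ} (hp : (n : ℤ) < p) : F.filProj p = 0 :=
  LinearMap.ext fun u => F.filProj_eq_zero_iff.2 (by
    rw [F.fil_of_nonpos (by omega)]
    exact ⟨complexConj H u, trivial, complexConj_complexConj u⟩)

theorem pieceProj_mul_filProj (b p : ℤ) :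
    F.pieceProj b * F.filProj p = if p ≤ b then F.pieceProj b else 0 := by
  rw [pieceProj, sub_mul, filProj_mul, filProj_mul]
  split_ifs with hp
  · rw [max_eq_left hp, max_eq_left (by omega)]
  · rw [max_eq_right (by omega), max_eq_right (by omega), sub_self]

theorem filProj_mul_pieceProj (b p : ℤ) :
    F.filProj p * F.pieceProj b = if p ≤ b then F.pieceProj b else 0 := by
  rw [pieceProj, mul_sub, filProj_mul, filProj_mul]
  split_ifs with hp
  · rw [max_eq_right hp, max_eq_right (by omega)]
  · rw [max_eq_left (by omega), max_eq_left (by omega), sub_self]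

/-- The `filProj p` form a decreasing chain of commuting projections, so their successive
differences are orthogonal idempotents. Since the chain runs from `1` to `0`, they sum to `1`, and
this is the Hodge decomposition. -/
theorem pieceProj_mul (a b : ℤ) :
    F.pieceProj a * F.pieceProj b = if a = b then F.pieceProj b else 0 := by
  conv_lhs => rw [pieceProj, sub_mul, filProj_mul_pieceProj, filProj_mul_pieceProj]
  split_ifs <;> first | omega | simp

theorem pieceProj_eq_zero {p : ℤ} (hp : p < 0 ∨ (n : ℤ) < p) : F.pieceProj p = 0 := by
  rw [pieceProj]
  rcases hp with hp | hp
  · rw [F.filProj_of_nonpos hp.le, F.filProj_of_nonpos (by omega), sub_self]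
  · rw [F.filProj_of_gt hp, F.filProj_of_gt (by omega), sub_self]

theorem sum_pieceProj : ∑ p ∈ Finset.range (n + 1), F.pieceProj p = 1 := by
  have h1 := Finset.sum_range_sub' (fun p : ℕ => F.filProj p) (n + 1)
  simp only [Nat.cast_zero, F.filProj_of_nonpos le_rfl,
    F.filProj_of_gt (p := ((n + 1 : ℕ) : ℤ)) (by push_cast; omega), sub_zero] at h1
  rw [← h1]
  exact Finset.sum_congr rfl fun p _ => by rw [pieceProj]; push_cast; rfl

theorem sum_pieceProj_apply (u : Complexification H) :
    ∑ p ∈ Finset.range (n + 1), F.pieceProj p u = u := by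
  rw [← LinearMap.sum_apply, F.sum_pieceProj, Module.End.one_apply]

theorem mem_hodgePiece_iff {p q : ℤ} (hpq : p + q = n) {u : Complexification H} :
    u ∈ hodgePiece F.fil p q ↔ F.pieceProj p u = u := by
  have hq : q = n - (p + 1) + 1 := by omega
  rw [hodgePiece, Submodule.mem_inf, hq, ← F.filProj_eq_zero_iff, ← F.filProj_eq_self_iff]
  constructor
  · rintro ⟨h1, h2⟩
    rw [pieceProj, LinearMap.sub_apply, h1, h2, sub_zero]
  · intro hu
    rw [← hu, ← Module.End.mul_apply, ← Module.End.mul_apply, filProj_mul_pieceProj,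
      filProj_mul_pieceProj, if_pos le_rfl, if_neg (by omega)]
    exact ⟨rfl, rfl⟩

theorem pieceProj_apply_mem {p q : ℤ} (hpq : p + q = n) (u : Complexification H) :
    F.pieceProj p u ∈ hodgePiece F.fil p q := by
  rw [F.mem_hodgePiece_iff hpq, ← Module.End.mul_apply, pieceProj_mul, if_pos rfl]

/-- `F^p` is orthogonal to `F^{n-p+1}`, and by conjugation so are the complements along which the
two projections are taken. Splitting both arguments leaves only the cross terms. -/
theorem form_filProj_left (p : ℤ) (u v : Complexification H) :
    complexForm Q (F.filProj p u) v = complexForm Q u (v - F.filProj (n - p + 1) v) := by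
  have h1 : complexForm Q (F.filProj p u) (F.filProj (n - p + 1) v) = 0 :=
    F.form_eq_zero p _ (F.filProj_mem _ _) _ (F.filProj_mem _ _)
  have h2 : complexForm Q (u - F.filProj p u) (v - F.filProj (n - p + 1) v) = 0 := by
    obtain ⟨a, ha, ha'⟩ := F.sub_filProj_mem p u
    obtain ⟨b, hb, hb'⟩ := F.sub_filProj_mem (n - p + 1) v
    rw [← ha', ← hb', complexForm_conj, F.form_eq_zero _ a ha b hb, map_zero]
  simp only [map_sub, LinearMap.sub_apply] at h2 ⊢
  linear_combination -h2 + h1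

theorem form_pieceProj_left (p : ℤ) (u v : Complexification H) :
    complexForm Q (F.pieceProj p u) v = complexForm Q u (F.pieceProj (n - p) v) := by
  simp only [pieceProj, LinearMap.sub_apply, map_sub, form_filProj_left]
  rw [show (n : ℤ) - (p + 1) + 1 = n - p by ring]
  ring

/-! ### Block decomposition of endomorphisms -/

/-- Since the `pieceProj` sum to `1`, an endomorphism is the sum of its Hodge blocks. Identities of
operators are checked below block by block. -/
theorem end_ext {A A' : Module.End ℂ (Complexification H)}
    (hA : ∀ a b, F.pieceProj b * A * F.pieceProj a = F.pieceProj b * A' * F.pieceProj a) :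
    A = A' := by
  have key : ∀ A : Module.End ℂ (Complexification H), A = ∑ b ∈ Finset.range (n + 1),
      ∑ a ∈ Finset.range (n + 1), F.pieceProj b * A * F.pieceProj a := by
    intro A
    simp_rw [← Finset.mul_sum, F.sum_pieceProj, mul_one, ← Finset.sum_mul, F.sum_pieceProj, one_mul]
  rw [key A, key A']
  exact Finset.sum_congr rfl fun b _ => Finset.sum_congr rfl fun a _ => hA a b

theorem pieceProj_eq_zero_or (a : ℤ) : F.pieceProj a = 0 ∨
    ∃ k ∈ Finset.range (n + 1), a = (k : ℤ) := by
  by_cases ha : a < 0 ∨ (n : ℤ) < a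
  · exact Or.inl (F.pieceProj_eq_zero ha)
  · refine Or.inr ⟨a.toNat, ?_, ?_⟩
    · rw [Finset.mem_range]; omega
    · omega

open Classical in
/-- The part of an endomorphism consisting of the blocks `H^{a,n-a} → H^{b,n-b}` whose degree
`b - a` satisfies `R`. -/
def degreePart (R : ℤ → Prop) :
    Module.End ℂ (Complexification H) →ₗ[ℂ] Module.End ℂ (Complexification H) where
  toFun A := ∑ b ∈ Finset.range (n + 1), ∑ a ∈ Finset.range (n + 1),
    if R ((b : ℤ) - a) then F.pieceProj b * A * F.pieceProj a else 0
  map_add' A A' := by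
    simp only [← Finset.sum_add_distrib, mul_add, add_mul]
    refine Finset.sum_congr rfl fun b _ => Finset.sum_congr rfl fun a _ => ?_
    split_ifs <;> simp
  map_smul' c A := by
    simp only [Finset.smul_sum, RingHom.id_apply, smul_ite, smul_zero, mul_smul_comm,
      smul_mul_assoc]

open Classical in
theorem block_degreePart (R : ℤ → Prop) (A : Module.End ℂ (Complexification H)) (a b : ℤ) :
    F.pieceProj b * F.degreePart R A * F.pieceProj a =
      if R (b - a) then F.pieceProj b * A * F.pieceProj a else 0 := by
  rcases F.pieceProj_eq_zero_or a with ha | ⟨k, hk, rfl⟩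
  · simp [ha]
  rcases F.pieceProj_eq_zero_or b with hb | ⟨l, hl, rfl⟩
  · simp [hb]
  simp only [degreePart, LinearMap.coe_mk, AddHom.coe_mk, Finset.mul_sum, Finset.sum_mul]
  rw [Finset.sum_eq_single_of_mem l hl, Finset.sum_eq_single_of_mem k hk]
  · split_ifs
    · rw [mul_assoc, mul_assoc, mul_assoc, pieceProj_mul, if_pos rfl, ← mul_assoc, ← mul_assoc,
        pieceProj_mul, if_pos rfl]
    · simp
  · intro k' _ hk'
    split_ifs
    · rw [mul_assoc, mul_assoc _ (F.pieceProj k'), pieceProj_mul, if_neg (by exact_mod_cast hk'),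
        mul_zero, mul_zero]
    · simp
  · intro l' _ hl'
    refine Finset.sum_eq_zero fun k' _ => ?_
    split_ifs
    · rw [mul_assoc (F.pieceProj l'), ← mul_assoc (F.pieceProj l), pieceProj_mul,
        if_neg (by exact_mod_cast hl'.symm), zero_mul, zero_mul]
    · simp

theorem degreePart_degreePart (R : ℤ → Prop) (A : Module.End ℂ (Complexification H)) :
    F.degreePart R (F.degreePart R A) = F.degreePart R A := by
  refine F.end_ext fun a b => ?_
  rw [block_degreePart]
  split_ifs with hR
  · rfl
  · rw [block_degreePart, if_neg hR]

theorem degreePart_eq_self_iff (R : ℤ → Prop) (A : Module.End ℂ (Complexification H)) :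
    F.degreePart R A = A ↔ ∀ a b, ¬ R (b - a) → F.pieceProj b * A * F.pieceProj a = 0 := by
  classical
  constructor
  · intro hA a b hR
    rw [← hA, block_degreePart, if_neg hR]
  · intro hA
    refine F.end_ext fun a b => ?_
    rw [block_degreePart]
    split_ifs with hR
    · rfl
    · rw [hA a b hR]

/-- `A F^p ⊆ F^{p+k}` in terms of blocks. -/
theorem forall_fil_iff (k : ℤ) (A : Module.End ℂ (Complexification H)) :
    (∀ p, ∀ u ∈ F.fil p, A u ∈ F.fil (p + k)) ↔
      ∀ a b, b < a + k → F.pieceProj b * A * F.pieceProj a = 0 := by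
  constructor
  · intro hA a b hab
    refine LinearMap.ext fun u => ?_
    have h1 : F.pieceProj a u ∈ F.fil a := by
      rw [← filProj_eq_self_iff, ← Module.End.mul_apply, filProj_mul_pieceProj, if_pos le_rfl]
    have h2 := F.filProj_eq_self_iff.2 (hA a _ h1)
    rw [Module.End.mul_apply, Module.End.mul_apply, ← h2, ← Module.End.mul_apply,
      pieceProj_mul_filProj, if_neg (by omega), LinearMap.zero_apply, LinearMap.zero_apply]
  · intro hA p u hu
    rw [← F.filProj_eq_self_iff.2 hu]
    suffices F.filProj (p + k) * A * F.filProj p = A * F.filProj p by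
      rw [← filProj_eq_self_iff]
      exact LinearMap.congr_fun this u
    refine F.end_ext fun a b => ?_
    have h1 : F.pieceProj b * (F.filProj (p + k) * A * F.filProj p) * F.pieceProj a =
        (F.pieceProj b * F.filProj (p + k)) * A * (F.filProj p * F.pieceProj a) := by
      simp only [mul_assoc]
    have h2 : F.pieceProj b * (A * F.filProj p) * F.pieceProj a =
        F.pieceProj b * A * (F.filProj p * F.pieceProj a) := by
      simp only [mul_assoc]
    rw [h1, h2, pieceProj_mul_filProj, filProj_mul_pieceProj]
    split_ifs with h1 h2 h2
    · rfl
    · simp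
    · rw [zero_mul, zero_mul, hA a b (by omega)]
    · simp

variable [FiniteDimensional ℚ H]

theorem formAdjoint_pieceProj (hQ : (complexForm Q).Nondegenerate) (p : ℤ) :
    formAdjoint (complexForm Q) hQ (F.pieceProj p) = F.pieceProj (n - p) :=
  formAdjoint_eq_of_form_eq hQ fun u v => by
    rw [form_pieceProj_left, sub_sub_cancel]

/-- The adjoint carries the block from degree `a` to `b` to the one from `n - b` to `n - a`, which
has the same shift. Hence the grading of `End H_ℂ` restricts to `𝒢_ℂ`, the `-1` eigenspace of the
adjoint. -/
theorem degreePart_formAdjoint (hQ : (complexForm Q).Nondegenerate) (R : ℤ → Prop)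
    (A : Module.End ℂ (Complexification H)) :
    F.degreePart R (formAdjoint (complexForm Q) hQ A) =
      formAdjoint (complexForm Q) hQ (F.degreePart R A) := by
  classical
  refine F.end_ext fun a b => ?_
  have key : ∀ A : Module.End ℂ (Complexification H),
      F.pieceProj b * formAdjoint (complexForm Q) hQ A * F.pieceProj a =
      formAdjoint (complexForm Q) hQ (F.pieceProj (n - a) * A * F.pieceProj (n - b)) := by
    intro A
    rw [formAdjoint_mul, formAdjoint_mul, formAdjoint_pieceProj, formAdjoint_pieceProj,
      sub_sub_cancel, sub_sub_cancel, mul_assoc]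
  rw [block_degreePart, key, key, block_degreePart,
    show (n : ℤ) - a - (n - b) = b - a by ring]
  split_ifs <;> simp

theorem mem_lieAlg_iff (hQ : (complexForm Q).Nondegenerate)
    (A : Module.End ℂ (Complexification H)) :
    A ∈ lieAlg Q ↔ formAdjoint (complexForm Q) hQ A = -A :=
  (formAdjoint_eq_neg_iff hQ).symm

theorem degreePart_mem_lieAlg (hQ : (complexForm Q).Nondegenerate) (R : ℤ → Prop)
    {A : Module.End ℂ (Complexification H)} (hA : A ∈ lieAlg Q) :
    F.degreePart R A ∈ lieAlg Q := by
  rw [mem_lieAlg_iff hQ] at hA ⊢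
  rw [← degreePart_formAdjoint, hA, map_neg]

end PeriodDomain

/-! ### The Lie algebra and its Hodge components -/

namespace PeriodDomain

variable {H : Type*} [AddCommGroup H] [Module ℚ H] {Q : LinearMap.BilinForm ℚ H} {n : ℕ}
  {h : ℕ → ℕ → ℕ} (F : PeriodDomain Q n h)

theorem mem_gr_iff {r : ℤ} {A : lieAlg Q} :
    A ∈ F.gr r ↔ ∀ a b, b ≠ a + r → F.pieceProj b * A.1 * F.pieceProj a = 0 := by
  constructor
  · intro hA a b hab
    refine LinearMap.ext fun u => ?_
    have h1 := hA a (n - a) (by ring) _ (F.pieceProj_apply_mem (by ring) u)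
    rw [F.mem_hodgePiece_iff (by ring)] at h1
    rw [Module.End.mul_apply, Module.End.mul_apply, ← h1, ← Module.End.mul_apply, pieceProj_mul,
      if_neg hab, LinearMap.zero_apply, LinearMap.zero_apply]
  · intro hA p q hpq u hu
    rw [F.mem_hodgePiece_iff hpq] at hu
    rw [F.mem_hodgePiece_iff (by omega), ← hu]
    suffices F.pieceProj (p + r) * A.1 * F.pieceProj p = A.1 * F.pieceProj p from
      LinearMap.congr_fun this u
    refine F.end_ext fun a b => ?_
    have h1 : F.pieceProj b * (F.pieceProj (p + r) * A.1 * F.pieceProj p) * F.pieceProj a =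
        (F.pieceProj b * F.pieceProj (p + r)) * A.1 * (F.pieceProj p * F.pieceProj a) := by
      simp only [mul_assoc]
    have h2 : F.pieceProj b * (A.1 * F.pieceProj p) * F.pieceProj a =
        F.pieceProj b * A.1 * (F.pieceProj p * F.pieceProj a) := by
      simp only [mul_assoc]
    rw [h1, h2, pieceProj_mul, pieceProj_mul]
    split_ifs with h3 h4 h4
    · rw [h3]
    · simp
    · rw [zero_mul, zero_mul, hA a b (by omega)]
    · simp

theorem mem_stab_iff {A : lieAlg Q} :
    A ∈ F.stab ↔ ∀ a b, b < a → F.pieceProj b * A.1 * F.pieceProj a = 0 := by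
  have := F.forall_fil_iff 0 A.1
  simp only [add_zero] at this
  exact this

theorem block_eq_zero_of_mem_compl {A : Module.End ℂ (Complexification H)} (hA : A ∈ F.compl) :
    A ∈ lieAlg Q ∧ ∀ a b, ¬ (b - a < 0) → F.pieceProj b * A * F.pieceProj a = 0 := by
  induction hA using Submodule.iSup_induction' with
  | mem r A hA =>
    obtain ⟨A, hA, rfl⟩ := hA
    refine ⟨A.2, fun a b hab => F.mem_gr_iff.1 hA a b ?_⟩
    have := r.2
    omega
  | zero => exact ⟨zero_mem _, by simp⟩
  | add A A' _ _ hA hA' =>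
    refine ⟨add_mem hA.1 hA'.1, fun a b hab => ?_⟩
    rw [mul_add, add_mul, hA.2 a b hab, hA'.2 a b hab, add_zero]

theorem compl_le_lieAlg : F.compl ≤ lieAlg Q := fun _ hA => (F.block_eq_zero_of_mem_compl hA).1

theorem degreePart_eq_self_of_mem_compl {A : Module.End ℂ (Complexification H)}
    (hA : A ∈ F.compl) : F.degreePart (· < 0) A = A :=
  (F.degreePart_eq_self_iff _ A).2 (F.block_eq_zero_of_mem_compl hA).2

theorem fil_sub_one_of_mem_gr {A : lieAlg Q} (hA : A ∈ F.gr (-1)) :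
    ∀ p, ∀ u ∈ F.fil p, A.1 u ∈ F.fil (p - 1) :=
  (F.forall_fil_iff (-1) A.1).2 fun a b hab => F.mem_gr_iff.1 hA a b (by omega)

theorem eq_zero_of_mem_gr_of_mem_stab {A : lieAlg Q} (hA : A ∈ F.gr (-1)) (hA' : A ∈ F.stab) :
    A = 0 := by
  refine Subtype.ext (F.end_ext fun a b => ?_)
  by_cases hab : b < a
  · rw [F.mem_stab_iff.1 hA' a b hab]; simp
  · rw [F.mem_gr_iff.1 hA a b (by omega)]; simp

theorem isNilpotent_of_mem_compl {A : Module.End ℂ (Complexification H)} (hA : A ∈ F.compl) :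
    IsNilpotent A := by
  have hA' := (F.block_eq_zero_of_mem_compl hA).2
  -- `A` strictly lowers the Hodge index, so whatever lands in index at least `p` comes from index
  -- at least `p + 1`. Iterating, `A ^ k` only sees `F^k`, and `F^{n+1} = 0`.
  have h1 : ∀ p : ℤ, F.filProj p * A = F.filProj p * A * F.filProj (p + 1) := by
    intro p
    refine F.end_ext fun a b => ?_
    have e1 : F.pieceProj b * (F.filProj p * A) * F.pieceProj a =
        (F.pieceProj b * F.filProj p) * A * F.pieceProj a := by simp only [mul_assoc]
    have e2 : F.pieceProj b * (F.filProj p * A * F.filProj (p + 1)) * F.pieceProj a =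
        (F.pieceProj b * F.filProj p) * A * (F.filProj (p + 1) * F.pieceProj a) := by
      simp only [mul_assoc]
    rw [e1, e2, pieceProj_mul_filProj, filProj_mul_pieceProj]
    split_ifs with h1 h2
    · rfl
    · rw [hA' a b (by omega), mul_zero]
    · simp
    · simp
  have h2 : ∀ k : ℕ, A ^ k = A ^ k * F.filProj k := by
    intro k
    induction k with
    | zero => simp [F.filProj_of_nonpos le_rfl]
    | succ k ih =>
      calc A ^ (k + 1) = A ^ k * F.filProj k * A := by rw [← ih, pow_succ]
        _ = A ^ k * F.filProj k * A * F.filProj (k + 1) := by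
            have := congrArg (A ^ k * ·) (h1 k)
            simpa only [mul_assoc] using this
        _ = _ := by rw [← ih, pow_succ]; push_cast; rfl
  exact ⟨n + 1, by rw [h2, F.filProj_of_gt (by push_cast; omega), mul_zero]⟩

variable [FiniteDimensional ℚ H]

theorem degreePart_mem_gr (hQ : (complexForm Q).Nondegenerate) (r : ℤ)
    {A : Module.End ℂ (Complexification H)} (hA : A ∈ lieAlg Q) :
    (⟨F.degreePart (· = r) A, F.degreePart_mem_lieAlg hQ _ hA⟩ : lieAlg Q) ∈ F.gr r := by
  classical
  refine F.mem_gr_iff.2 fun a b hab => ?_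
  simp only
  rw [block_degreePart, if_neg (by omega)]

/-- `A` is the sum of its homogeneous parts, each of which is again in `𝒢_ℂ`; the degrees are
bounded by `n` in absolute value. -/
theorem mem_compl_of_block_eq_zero (hQ : (complexForm Q).Nondegenerate)
    {A : Module.End ℂ (Complexification H)} (hA : A ∈ lieAlg Q)
    (hA' : ∀ a b, ¬ (b - a < 0) → F.pieceProj b * A * F.pieceProj a = 0) : A ∈ F.compl := by
  classical
  have key : A = ∑ r ∈ Finset.range (n + 1), F.degreePart (· = (-r : ℤ)) A := by
    refine F.end_ext fun a b => ?_
    rw [Finset.mul_sum, Finset.sum_mul]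
    simp only [block_degreePart]
    by_cases hab : b - a < 0
    · rcases F.pieceProj_eq_zero_or a with ha | ⟨k, hk, rfl⟩
      · simp [ha]
      rcases F.pieceProj_eq_zero_or b with hb | ⟨l, hl, rfl⟩
      · simp [hb]
      rw [Finset.mem_range] at hk hl
      rw [Finset.sum_eq_single_of_mem (k - l) (Finset.mem_range.2 (by omega)), if_pos (by omega)]
      intro r _ hr
      rw [if_neg (by omega)]
    · rw [hA' a b hab]; simp
  rw [key]
  refine Submodule.sum_mem _ fun r _ => ?_
  rcases Nat.eq_zero_or_pos r with hr | hr
  · have : F.degreePart (· = (-r : ℤ)) A = 0 := by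
      refine F.end_ext fun a b => ?_
      rw [block_degreePart]
      split_ifs with h1
      · rw [hA' a b (by omega)]; simp
      · simp
    rw [this]
    exact zero_mem _
  · exact Submodule.mem_iSup_of_mem (⟨r, by exact_mod_cast hr⟩ : {r : ℤ // 0 < r})
      ⟨_, F.degreePart_mem_gr hQ _ hA, rfl⟩

theorem degreePart_mem_compl (hQ : (complexForm Q).Nondegenerate)
    {A : Module.End ℂ (Complexification H)} (hA : A ∈ lieAlg Q) :
    F.degreePart (· < 0) A ∈ F.compl := by
  classical
  refine F.mem_compl_of_block_eq_zero hQ (F.degreePart_mem_lieAlg hQ _ hA) fun a b hab => ?_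
  rw [block_degreePart, if_neg hab]

/-- Blocks that do not lower the Hodge index preserve the filtration, so they can be added or
dropped without changing the tangent vector. -/
theorem mkQ_degreePart (hQ : (complexForm Q).Nondegenerate) (A : lieAlg Q) (R : ℤ → Prop)
    (hR : ∀ a b, b < a → ¬ R (b - a) → F.pieceProj b * A.1 * F.pieceProj a = 0) :
    F.stab.mkQ ⟨F.degreePart R A.1, F.degreePart_mem_lieAlg hQ _ A.2⟩ = F.stab.mkQ A := by
  classical
  rw [Submodule.mkQ_apply, Submodule.mkQ_apply, Submodule.Quotient.eq, mem_stab_iff]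
  intro a b hab
  rw [Submodule.coe_sub, mul_sub, sub_mul]
  simp only
  rw [block_degreePart]
  split_ifs with h1
  · rw [sub_self]
  · rw [hR a b hab h1, sub_zero]

/-- An element of `𝒢_ℂ` that shifts the filtration by at most one is horizontal. -/
theorem mkQ_mem_horizontal (hQ : (complexForm Q).Nondegenerate) (A : lieAlg Q)
    (hA : ∀ p, ∀ u ∈ F.fil p, A.1 u ∈ F.fil (p - 1)) : F.stab.mkQ A ∈ F.horizontal := by
  have h1 := (F.forall_fil_iff (-1) A.1).1 hA
  rw [← F.mkQ_degreePart hQ A (· = -1) fun a b hab hR => h1 a b (by omega)]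
  exact Submodule.mem_map_of_mem (F.degreePart_mem_gr hQ _ A.2)

/-! ### `𝒢^{-1,1}` generates the negative part -/

section Generation

variable {H : Type*} [AddCommGroup H] [Module ℚ H] {Q : LinearMap.BilinForm ℚ H} {n : ℕ}
  {h : ℕ → ℕ → ℕ}

/-- The element `w ↦ Q (v, w) u - (-1)^n Q (u, w) v` of `𝒢_ℂ`. -/
def skewEnd (Q : LinearMap.BilinForm ℚ H) (n : ℕ) :
    Complexification H →ₗ[ℂ] Complexification H →ₗ[ℂ] Module.End ℂ (Complexification H) :=
  LinearMap.mk₂ ℂ (fun u v => (complexForm Q v).smulRight u -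
      ((-1 : ℂ) ^ n) • (complexForm Q u).smulRight v)
    (by intro u u' v; ext w; simp [smul_add, add_smul]; abel)
    (by intro c u v; ext w; simp [smul_sub, smul_smul]; ring_nf)
    (by intro u v v'; ext w; simp [smul_add, add_smul]; abel)
    (by intro c u v; ext w; simp [smul_sub, smul_smul]; ring_nf)

theorem skewEnd_apply (u v w : Complexification H) :
    skewEnd Q n u v w = complexForm Q v w • u - ((-1) ^ n * complexForm Q u w) • v := by
  simp [skewEnd, smul_smul]

theorem skewEnd_mem_lieAlg (hQs : ∀ u v, Q u v = (-1) ^ n * Q v u) (u v : Complexification H) :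
    skewEnd Q n u v ∈ lieAlg Q := by
  intro w w'
  have hs := complexForm_symm Q n hQs
  have h2 : ((-1 : ℂ) ^ n) * (-1) ^ n = 1 := by rw [← mul_pow]; simp
  simp only [skewEnd_apply, map_sub, map_smul, LinearMap.sub_apply, LinearMap.smul_apply,
    smul_eq_mul]
  rw [hs w u, hs w v]
  linear_combination (-(complexForm Q u w' * complexForm Q v w)) * h2

/-- `skewEnd` factors through `Λ² H_ℂ` for even `n` and through `Sym² H_ℂ` for odd `n`. -/
theorem skewEnd_swap (u v : Complexification H) :
    skewEnd Q n v u = skewEnd Q n u ((-(-1 : ℂ) ^ n) • v) := by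
  have h2 : ((-1 : ℂ) ^ n) * (-1) ^ n = 1 := by rw [← mul_pow]; simp
  refine LinearMap.ext fun w => ?_
  rw [map_smul, LinearMap.smul_apply, skewEnd_apply, skewEnd_apply, smul_sub, smul_smul, smul_smul]
  rw [show -(-1 : ℂ) ^ n * ((-1) ^ n * complexForm Q u w) = -complexForm Q u w by
    linear_combination (-complexForm Q u w) * h2]
  module

/-- Equivariance: an infinitesimal isometry acts on `u ⊗ v` as a derivation. This is what computes
brackets with `𝒢^{-1,1}`. -/
theorem commutator_skewEnd {X : Module.End ℂ (Complexification H)} (hX : X ∈ lieAlg Q)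
    (u v : Complexification H) :
    X * skewEnd Q n u v - skewEnd Q n u v * X = skewEnd Q n (X u) v + skewEnd Q n u (X v) := by
  refine LinearMap.ext fun w => ?_
  have h1 : complexForm Q v (X w) = -complexForm Q (X v) w := by
    linear_combination hX v w
  have h2 : complexForm Q u (X w) = -complexForm Q (X u) w := by
    linear_combination hX u w
  simp only [LinearMap.sub_apply, LinearMap.add_apply, Module.End.mul_apply, skewEnd_apply,
    map_sub, map_smul, h1, h2]
  module

variable (F : PeriodDomain Q n h)

theorem form_eq_zero_of_pieceProj {a b : ℤ} (hab : a + b ≠ n) {u v : Complexification H}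
    (hu : F.pieceProj a u = u) (hv : F.pieceProj b v = v) : complexForm Q u v = 0 := by
  rw [← hu, form_pieceProj_left, ← hv, ← Module.End.mul_apply, pieceProj_mul, if_neg (by omega),
    LinearMap.zero_apply, map_zero]

/-- `Q (v, ·)` sees only `H^{n-b,b}` and the result lies in `H^{a,n-a}`, a shift of `a + b - n`; the
other term has the same shift. -/
theorem block_skewEnd {a b : ℤ} {u v : Complexification H}
    (hu : F.pieceProj a u = u) (hv : F.pieceProj b v = v) (k l : ℤ) (hkl : l - k ≠ a + b - n) :
    F.pieceProj l * skewEnd Q n u v * F.pieceProj k = 0 := by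
  refine LinearMap.ext fun w => ?_
  have hw : F.pieceProj k (F.pieceProj k w) = F.pieceProj k w := by
    rw [← Module.End.mul_apply, pieceProj_mul, if_pos rfl]
  have key : ∀ {c d : ℤ} {x y : Complexification H}, c + d = a + b → F.pieceProj c x = x →
      F.pieceProj d y = y → complexForm Q y (F.pieceProj k w) • F.pieceProj l x = 0 := by
    intro c d x y hcd hx hy
    by_cases hdk : d + k = n
    · rw [← hx, ← Module.End.mul_apply, pieceProj_mul, if_neg (by omega), LinearMap.zero_apply,
        smul_zero]
    · rw [F.form_eq_zero_of_pieceProj hdk hy hw, zero_smul]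
  rw [Module.End.mul_apply, Module.End.mul_apply, skewEnd_apply, map_sub, map_smul, map_smul,
    key rfl hu hv, mul_smul, key (add_comm b a) hv hu, smul_zero, sub_zero, LinearMap.zero_apply]

/-- The only place where the nonvanishing of the Hodge numbers enters. -/
theorem exists_pieceProj_ne_zero (hh : ∀ p q, p + q = n → h p q ≠ 0) {a : ℤ} (ha : 0 ≤ a)
    (han : a ≤ n) : ∃ u, u ≠ 0 ∧ F.pieceProj a u = u := by
  lift a to ℕ using ha
  have han' : a ≤ n := by exact_mod_cast han
  have h1 : Module.finrank ℂ (hodgePiece F.fil (a : ℤ) ((n - a : ℕ) : ℤ)) ≠ 0 := by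
    rw [F.finrank_hodgePiece a (n - a) (by omega)]
    exact hh _ _ (by omega)
  have h2 : hodgePiece F.fil (a : ℤ) ((n - a : ℕ) : ℤ) ≠ ⊥ := fun h0 => h1 (by rw [h0]; simp)
  obtain ⟨u, hu, hu0⟩ := Submodule.exists_mem_ne_zero_of_ne_bot h2
  exact ⟨u, hu0, (F.mem_hodgePiece_iff (by omega)).1 hu⟩

theorem exists_form_eq_one (hQ : (complexForm Q).Nondegenerate) {a b : ℤ} (hab : a + b = n)
    {u : Complexification H} (hu0 : u ≠ 0) (hu : F.pieceProj a u = u) :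
    ∃ v, F.pieceProj b v = v ∧ complexForm Q u v = 1 := by
  obtain ⟨z, hz⟩ : ∃ z, complexForm Q u z ≠ 0 := by
    by_contra! h0
    exact hu0 (hQ.1 u h0)
  refine ⟨(complexForm Q u z)⁻¹ • F.pieceProj b z, ?_, ?_⟩
  · rw [map_smul, ← Module.End.mul_apply, pieceProj_mul, if_pos rfl]
  · have : complexForm Q u (F.pieceProj b z) = complexForm Q u z := by
      rw [show b = n - a by omega, ← form_pieceProj_left, hu]
    rw [map_smul, this, smul_eq_mul, inv_mul_cancel₀ hz]

/-- The step that realizes `skewEnd u v` as a bracket with an element of `𝒢^{-1,1}`. -/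
theorem exists_mem_gr_neg_one (hn : ∀ p q, p + q = n → h p q ≠ 0)
    (hQ : (complexForm Q).Nondegenerate) (hQs : ∀ u v, Q u v = (-1) ^ n * Q v u)
    {a b : ℤ} (ha : 0 ≤ a) (hb : 0 ≤ b) (hab : a + b + 2 ≤ n) (hba : b ≠ a + 1)
    {u v : Complexification H} (hu0 : u ≠ 0)
    (hu : F.pieceProj a u = u) (hv : F.pieceProj b v = v) :
    ∃ X : lieAlg Q, X ∈ F.gr (-1) ∧ ∃ u', F.pieceProj (a + 1) u' = u' ∧ X.1 u' = u ∧
      X.1 v = 0 := by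
  have hgr : ∀ {y}, F.pieceProj (n - 1 - a) y = y →
      (⟨skewEnd Q n u y, skewEnd_mem_lieAlg hQs u y⟩ : lieAlg Q) ∈ F.gr (-1) := by
    intro y hy
    exact F.mem_gr_iff.2 fun k l hkl => F.block_skewEnd hu hy k l (by omega)
  -- If `2a + 1 = n`, then `H^{a+1,n-a-1}` is dual to `H^{a,n-a}` itself and `skewEnd u u` is the
  -- symmetric square of `u`. Both of its terms contribute to `X u'`, whence the factor `1/2`.
  by_cases h2a : 2 * a + 1 = n
  · obtain ⟨u', hu', huu'⟩ := F.exists_form_eq_one hQ (b := a + 1) (by omega) hu0 hu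
    have hodd : (-1 : ℂ) ^ n = -1 := Odd.neg_one_pow ⟨a.toNat, by omega⟩
    have hy : F.pieceProj (n - 1 - a) ((1 / 2 : ℂ) • u) = (1 / 2 : ℂ) • u := by
      rw [map_smul, show (n : ℤ) - 1 - a = a by omega, hu]
    refine ⟨_, hgr hy, u', hu', ?_, ?_⟩
    · simp only [skewEnd_apply, map_smul, LinearMap.smul_apply, huu', hodd]
      module
    · simp only [skewEnd_apply, map_smul, LinearMap.smul_apply,
        F.form_eq_zero_of_pieceProj (by omega) hu hv]
      module
  -- Otherwise `u ⊥ u'`, so with `y` dual to `u'` only one term of `skewEnd u y` acts on `u'`. As `b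
  -- ≠ a + 1`, both `y` and `u` are orthogonal to `v`.
  · obtain ⟨u', hu'0, hu'⟩ := F.exists_pieceProj_ne_zero hn (a := a + 1) (by omega) (by omega)
    obtain ⟨y, hy, hyu'⟩ := F.exists_form_eq_one hQ (b := n - 1 - a) (by omega) hu'0 hu'
    have hy' : F.pieceProj (n - 1 - a) (((-1 : ℂ) ^ n) • y) = ((-1 : ℂ) ^ n) • y := by
      rw [map_smul, hy]
    have h2 : ((-1 : ℂ) ^ n) * (-1) ^ n = 1 := by rw [← mul_pow]; simp
    refine ⟨_, hgr hy', u', hu', ?_, ?_⟩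
    · rw [skewEnd_apply, map_smul, LinearMap.smul_apply, complexForm_symm Q n hQs y u', hyu',
        F.form_eq_zero_of_pieceProj (by omega) hu hu', mul_one, smul_eq_mul, h2]
      module
    · rw [skewEnd_apply, F.form_eq_zero_of_pieceProj (by omega) hy' hv,
        F.form_eq_zero_of_pieceProj (by omega) hu hv]
      module

/-- Induction on the depth: an operator of degree `-(r+2)` is the bracket of some `X ∈ 𝒢^{-1,1}`
with one of degree `-(r+1)`. Only additivity of `K` is required, because for a real differential the
annihilated fields are not a priori a complex subspace. -/
theorem skewEnd_mem_of_bracket_closed (hn : ∀ p q, p + q = n → h p q ≠ 0)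
    (hQ : (complexForm Q).Nondegenerate) (hQs : ∀ u v, Q u v = (-1) ^ n * Q v u)
    (K : AddSubgroup (Module.End ℂ (Complexification H)))
    (hK : ∀ X ∈ F.gr (-1), X.1 ∈ K)
    (hK' : ∀ X ∈ F.gr (-1), ∀ A ∈ lieAlg Q, A ∈ K → X.1 * A - A * X.1 ∈ K) (r : ℕ) :
    ∀ (a b : ℤ), a + b + (r + 1) = n → ∀ u v, F.pieceProj a u = u → F.pieceProj b v = v →
      skewEnd Q n u v ∈ K := by
  induction r with
  | zero =>
    intro a b hab u v hu hv
    exact hK ⟨_, skewEnd_mem_lieAlg hQs u v⟩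
      (F.mem_gr_iff.2 fun k l hkl => F.block_skewEnd hu hv k l (by omega))
  | succ r ih =>
    have hpos : ∀ {a : ℤ} {u}, F.pieceProj a u = u → u ≠ 0 → 0 ≤ a := by
      intro a u hu hu0
      by_contra ha
      rw [F.pieceProj_eq_zero (Or.inl (by omega)), LinearMap.zero_apply] at hu
      exact hu0 hu.symm
    have key : ∀ (a b : ℤ), a + b + ((r + 1 : ℕ) + 1) = n → b ≠ a + 1 → ∀ u v,
        F.pieceProj a u = u → F.pieceProj b v = v → skewEnd Q n u v ∈ K := by
      intro a b hab hba u v hu hv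
      by_cases hu0 : u = 0
      · rw [hu0, map_zero, LinearMap.zero_apply]; exact zero_mem _
      by_cases hv0 : v = 0
      · rw [hv0, map_zero]; exact zero_mem _
      push_cast at hab
      obtain ⟨X, hX, u', hu', hXu', hXv⟩ := F.exists_mem_gr_neg_one hn hQ hQs (hpos hu hu0)
        (hpos hv hv0) (by omega) hba hu0 hu hv
      have h1 := hK' X hX _ (skewEnd_mem_lieAlg hQs u' v)
        (ih (a + 1) b (by omega) u' v hu' hv)
      rwa [commutator_skewEnd X.2, hXu', hXv, map_zero, add_zero] at h1
    intro a b hab u v hu hv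
    -- In the excluded case the roles of `u` and `v` are exchanged, since `b = a + 1` rules out `a =
    -- b + 1`.
    by_cases hba : b = a + 1
    · rw [skewEnd_swap v u, map_smul]
      have := key b a (by omega) (by omega) v (-(-1 : ℂ) ^ n • u) hv (by
        rw [neg_smul, map_neg, map_smul, hu])
      rwa [neg_smul, map_neg, map_smul, ← neg_smul] at this
    · exact key a b hab hba u v hu hv

/-- With dual bases, `A = ∑ Q(bⁱ, ·) A bᵢ`. Skewness of `A` makes the second term of `skewEnd`
reproduce `A` too, so each `A bᵢ` is halved. -/
theorem eq_sum_skewEnd [FiniteDimensional ℚ H] (hQ : (complexForm Q).Nondegenerate)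
    (hQs : ∀ u v, Q u v = (-1) ^ n * Q v u)
    {A : Module.End ℂ (Complexification H)} (hA : A ∈ lieAlg Q) :
    ∃ (m : ℕ) (x y : Fin m → Complexification H), A = ∑ i, skewEnd Q n (x i) (y i) := by
  classical
  let b := Module.finBasis ℂ (Complexification H)
  refine ⟨_, fun i => (1 / 2 : ℂ) • A (b i), (complexForm Q).dualBasis hQ b, b.ext fun j => ?_⟩
  have h2 : ((-1 : ℂ) ^ n) * (-1) ^ n = 1 := by rw [← mul_pow]; simp
  have h3 : ∑ i, complexForm Q (A (b j)) (b i) • (complexForm Q).dualBasis hQ b i = A (b j) := by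
    conv_rhs => rw [← ((complexForm Q).dualBasis hQ b).sum_repr (A (b j))]
    refine Finset.sum_congr rfl fun i _ => ?_
    rw [LinearMap.BilinForm.dualBasis_repr_apply]
  rw [LinearMap.sum_apply]
  have h4 : ∀ i, skewEnd Q n ((1 / 2 : ℂ) • A (b i)) ((complexForm Q).dualBasis hQ b i) (b j) =
      (1 / 2 : ℂ) • ((if j = i then A (b i) else 0) +
        complexForm Q (A (b j)) (b i) • (complexForm Q).dualBasis hQ b i) := by
    intro i
    rw [skewEnd_apply, LinearMap.BilinForm.apply_dualBasis_left, map_smul, LinearMap.smul_apply,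
      smul_eq_mul]
    have e1 : complexForm Q (A (b i)) (b j) = -((-1) ^ n * complexForm Q (A (b j)) (b i)) := by
      rw [← complexForm_symm Q n hQs]
      linear_combination hA (b i) (b j)
    rw [e1, show (-1 : ℂ) ^ n * (1 / 2 * -((-1) ^ n * complexForm Q (A (b j)) (b i))) =
      -(1 / 2 * complexForm Q (A (b j)) (b i)) by
        linear_combination (-(1 / 2 * complexForm Q (A (b j)) (b i))) * h2]
    split_ifs <;> module
  rw [Finset.sum_congr rfl fun i _ => h4 i, ← Finset.smul_sum, Finset.sum_add_distrib, h3,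
    Finset.sum_ite_eq Finset.univ j]
  simp only [Finset.mem_univ, if_true]
  module

/-- `𝒢^{-1,1}` generates `⊕_{r > 0} 𝒢^{-r,r}` as a Lie algebra. -/
theorem compl_le_of_bracket_closed [FiniteDimensional ℚ H] (hn : ∀ p q, p + q = n → h p q ≠ 0)
    (hQ : (complexForm Q).Nondegenerate) (hQs : ∀ u v, Q u v = (-1) ^ n * Q v u)
    (K : AddSubgroup (Module.End ℂ (Complexification H)))
    (hK : ∀ X ∈ F.gr (-1), X.1 ∈ K)
    (hK' : ∀ X ∈ F.gr (-1), ∀ A ∈ lieAlg Q, A ∈ K → X.1 * A - A * X.1 ∈ K)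
    {A : Module.End ℂ (Complexification H)} (hA : A ∈ F.compl) : A ∈ K := by
  obtain ⟨m, x, y, hxy⟩ := eq_sum_skewEnd hQ hQs (F.compl_le_lieAlg hA)
  rw [← F.degreePart_eq_self_of_mem_compl hA, hxy, map_sum]
  refine sum_mem fun i _ => ?_
  rw [← F.sum_pieceProj_apply (x i), ← F.sum_pieceProj_apply (y i)]
  simp only [map_sum, LinearMap.sum_apply]
  refine sum_mem fun a _ => sum_mem fun b _ => ?_
  have hu : ∀ (a : ℤ) (u), F.pieceProj a (F.pieceProj a u) = F.pieceProj a u := fun a u => by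
    rw [← Module.End.mul_apply, pieceProj_mul, if_pos rfl]
  have hbl := F.block_skewEnd (hu b (x i)) (hu a (y i))
  by_cases hab : (b : ℤ) + a < n
  · rw [(F.degreePart_eq_self_iff _ _).2 fun k l hkl => hbl k l (by omega)]
    exact F.skewEnd_mem_of_bracket_closed hn hQ hQs K hK hK' (n - 1 - a - b) b a (by omega) _ _
      (hu _ _) (hu _ _)
  · have : F.degreePart (· < 0) (skewEnd Q n (F.pieceProj b (x i)) (F.pieceProj a (y i))) = 0 := by
      refine F.end_ext fun k l => ?_
      rw [block_degreePart]
      split_ifs with h1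
      · rw [hbl k l (by omega)]; simp
      · simp
    rw [this]
    exact zero_mem _

end Generation

end PeriodDomain

/-! ### Auxiliary norms -/

section Norms

variable (H : Type*) [AddCommGroup H] [Module ℚ H] [FiniteDimensional ℚ H]

/-- The norm of the coordinates with respect to some basis of `H_ℂ`. -/
abbrev complexificationNorm : NormedAddCommGroup (Complexification H) :=
  NormedAddCommGroup.induced _ _ (Module.finBasis ℂ (Complexification H)).equivFun
    (LinearEquiv.injective _)

attribute [local instance] complexificationNorm

/-- `H_ℂ` as a normed space. -/
abbrev complexificationNormedSpace : NormedSpace ℂ (Complexification H) :=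
  NormedSpace.induced ℂ _ _ (Module.finBasis ℂ (Complexification H)).equivFun

attribute [local instance] complexificationNormedSpace

/-- The operator norm on `End H_ℂ`. -/
abbrev endNormedRing : NormedRing (Module.End ℂ (Complexification H)) :=
  NormedRing.induced _ _ (Module.End.toContinuousLinearMap (Complexification H))
    (AlgEquiv.injective _)

attribute [local instance] endNormedRing

/-- `End H_ℂ` as a normed algebra. -/
abbrev endNormedAlgebra : NormedAlgebra ℂ (Module.End ℂ (Complexification H)) :=
  NormedAlgebra.induced ℂ _ _ (Module.End.toContinuousLinearMap (Complexification H))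

attribute [local instance] endNormedAlgebra

theorem completeSpace_end : CompleteSpace (Module.End ℂ (Complexification H)) :=
  FiniteDimensional.complete ℂ _

end Norms

attribute [local instance] complexificationNorm complexificationNormedSpace endNormedRing
  endNormedAlgebra completeSpace_end

theorem continuous_bilinear {X Y Z : Type*} [NormedAddCommGroup X] [NormedSpace ℂ X]
    [FiniteDimensional ℂ X] [NormedAddCommGroup Y] [NormedSpace ℂ Y] [FiniteDimensional ℂ Y]
    [NormedAddCommGroup Z] [NormedSpace ℂ Z] (f : X →ₗ[ℂ] Y →ₗ[ℂ] Z) :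
    Continuous fun p : X × Y => f p.1 p.2 := by
  have h1 : Continuous fun x : X =>
      (LinearMap.toContinuousLinearMap : (Y →ₗ[ℂ] Z) ≃ₗ[ℂ] Y →L[ℂ] Z) (f x) :=
    ((LinearMap.toContinuousLinearMap : (Y →ₗ[ℂ] Z) ≃ₗ[ℂ] Y →L[ℂ] Z).toLinearMap ∘ₗ
      f).continuous_of_finiteDimensional
  exact (h1.comp continuous_fst).clm_apply continuous_snd

/-! ### Stability of polarized Hodge structures under elements of the complex group near the
identity -/

namespace PeriodDomain

variable {H : Type*} [AddCommGroup H] [Module ℚ H] {Q : LinearMap.BilinForm ℚ H} {n : ℕ}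
  {h : ℕ → ℕ → ℕ}

/-- The conjugate endomorphism `conj ∘ g ∘ conj`. -/
def conjEnd (H : Type*) [AddCommGroup H] [Module ℚ H] :
    Module.End ℂ (Complexification H) →ₛₗ[starRingEnd ℂ] Module.End ℂ (Complexification H) where
  toFun g :=
    { toFun := fun u => complexConj H (g (complexConj H u))
      map_add' := by intro u v; simp only [map_add]
      map_smul' := by
        intro c u
        simp only [LinearMap.map_smulₛₗ, map_smul, Complex.conj_conj, RingHom.id_apply] }
  map_add' g g' := by ext u; simp
  map_smul' c g := by ext u; simp

theorem conjEnd_apply (g : Module.End ℂ (Complexification H)) (u : Complexification H) :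
    conjEnd H g u = complexConj H (g (complexConj H u)) := rfl

theorem map_map_conj (g : Module.End ℂ (Complexification H))
    (S : Submodule ℂ (Complexification H)) :
    (S.map g).map (complexConj H) = (S.map (complexConj H)).map (conjEnd H g) := by
  ext u
  constructor
  · rintro ⟨_, ⟨v, hv, rfl⟩, rfl⟩
    exact ⟨_, ⟨v, hv, rfl⟩, by rw [conjEnd_apply, complexConj_complexConj]⟩
  · rintro ⟨_, ⟨v, hv, rfl⟩, rfl⟩
    exact ⟨_, ⟨v, hv, rfl⟩, by rw [conjEnd_apply, complexConj_complexConj]⟩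

variable (F : PeriodDomain Q n h)

/-- The endomorphism that is `g` on `F^p` and `conj g` on `conj F^{n-p+1}`. -/
def splitEnd (p : ℤ) (g : Module.End ℂ (Complexification H)) : Module.End ℂ (Complexification H) :=
  g * F.filProj p + conjEnd H g * (1 - F.filProj p)

theorem splitEnd_apply_of_mem {p : ℤ} (g : Module.End ℂ (Complexification H))
    {u : Complexification H} (hu : u ∈ F.fil p) : F.splitEnd p g u = g u := by
  simp [splitEnd, F.filProj_eq_self_iff.2 hu]

theorem splitEnd_apply_of_mem_conj {p : ℤ} (g : Module.End ℂ (Complexification H))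
    {u : Complexification H} (hu : u ∈ (F.fil (n - p + 1)).map (complexConj H)) :
    F.splitEnd p g u = conjEnd H g u := by
  simp [splitEnd, F.filProj_eq_zero_iff.2 hu]

theorem splitEnd_one (p : ℤ) : F.splitEnd p 1 = 1 := by
  have : conjEnd H 1 = 1 := by ext u; simp [conjEnd_apply]
  rw [splitEnd, this, one_mul, one_mul, add_sub_cancel]

theorem map_splitEnd_fil (p : ℤ) (g : Module.End ℂ (Complexification H)) :
    (F.fil p).map (F.splitEnd p g) = (F.fil p).map g :=
  SetLike.coe_injective (Set.image_congr fun _ hu => F.splitEnd_apply_of_mem g hu)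

theorem map_splitEnd_conj (p : ℤ) (g : Module.End ℂ (Complexification H)) :
    ((F.fil (n - p + 1)).map (complexConj H)).map (F.splitEnd p g) =
      ((F.fil (n - p + 1)).map g).map (complexConj H) := by
  rw [map_map_conj]
  exact SetLike.coe_injective (Set.image_congr fun _ hu => F.splitEnd_apply_of_mem_conj g hu)

/-- `splitEnd p g` carries the complementary pair at `F` to the pair at `g F`, so complementarity
reduces to invertibility, an open condition on `g`. -/
theorem isCompl_map_of_isUnit {p : ℤ} {g : Module.End ℂ (Complexification H)}
    (hg : IsUnit (F.splitEnd p g)) :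
    IsCompl ((F.fil p).map g) (((F.fil (n - p + 1)).map g).map (complexConj H)) := by
  rw [← map_splitEnd_fil, ← map_splitEnd_conj]
  have hb := (Module.End.isUnit_iff _).1 hg
  exact (F.isCompl_fil p).map (Submodule.orderIsoMapComap (LinearEquiv.ofBijective _ hb))

/-- The projection onto `g F^p` along `conj (g F^{n-p+1})`, where these are complementary. -/
def movedProj (p : ℤ) (g : Module.End ℂ (Complexification H)) :
    Module.End ℂ (Complexification H) :=
  F.splitEnd p g * F.filProj p * Ring.inverse (F.splitEnd p g)

theorem movedProj_apply_of_mem {p : ℤ} {g : Module.End ℂ (Complexification H)}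
    (hg : IsUnit (F.splitEnd p g)) {u : Complexification H} (hu : u ∈ (F.fil p).map g) :
    F.movedProj p g u = u := by
  rw [← map_splitEnd_fil] at hu
  obtain ⟨v, hv, rfl⟩ := hu
  have h1 := LinearMap.congr_fun (Ring.inverse_mul_cancel _ hg) v
  rw [Module.End.mul_apply, Module.End.one_apply] at h1
  rw [movedProj, Module.End.mul_apply, Module.End.mul_apply, h1, F.filProj_eq_self_iff.2 hv]

theorem movedProj_apply_of_mem_conj {p : ℤ} {g : Module.End ℂ (Complexification H)}
    (hg : IsUnit (F.splitEnd p g)) {u : Complexification H}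
    (hu : u ∈ ((F.fil (n - p + 1)).map g).map (complexConj H)) : F.movedProj p g u = 0 := by
  rw [← map_splitEnd_conj] at hu
  obtain ⟨v, hv, rfl⟩ := hu
  have h1 := LinearMap.congr_fun (Ring.inverse_mul_cancel _ hg) v
  rw [Module.End.mul_apply, Module.End.one_apply] at h1
  rw [movedProj, Module.End.mul_apply, Module.End.mul_apply, h1, F.filProj_eq_zero_iff.2 hv,
    map_zero]

/-- The Weil operator of the translated filtration `g F`. -/
def movedWeil (g : Module.End ℂ (Complexification H)) : Module.End ℂ (Complexification H) :=
  ∑ p ∈ Finset.range (n + 1), Complex.I ^ ((p : ℤ) - ((n : ℤ) - p)) •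
    (F.movedProj p g - F.movedProj (p + 1) g)

theorem movedWeil_apply {g : Module.End ℂ (Complexification H)}
    (hg : ∀ p, IsUnit (F.splitEnd p g)) {u : ℕ → Complexification H}
    (hu : ∀ p ∈ Finset.range (n + 1),
      u p ∈ hodgePiece (fun p => (F.fil p).map g) p ((n : ℤ) - p)) :
    F.movedWeil g (∑ p ∈ Finset.range (n + 1), u p) =
      ∑ p ∈ Finset.range (n + 1), Complex.I ^ ((p : ℤ) - ((n : ℤ) - p)) • u p := by
  have h1 : ∀ (q : ℤ), ∀ r ∈ Finset.range (n + 1),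
      F.movedProj q g (u r) = if q ≤ r then u r else 0 := by
    intro q r hr
    obtain ⟨hr1, hr2⟩ := hu r hr
    split_ifs with hq
    · exact F.movedProj_apply_of_mem (hg q) (Submodule.map_mono (F.antitone_fil hq) hr1)
    · refine F.movedProj_apply_of_mem_conj (hg q)
        (Submodule.map_mono (Submodule.map_mono (F.antitone_fil (by omega))) hr2)
  rw [movedWeil, LinearMap.sum_apply]
  refine Finset.sum_congr rfl fun p hp => ?_
  rw [LinearMap.smul_apply, map_sum, Finset.sum_eq_single_of_mem p hp]
  · rw [LinearMap.sub_apply, h1 _ p hp, h1 _ p hp, if_pos le_rfl, if_neg (by omega), sub_zero]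
  · intro r hr hrp
    rw [LinearMap.sub_apply, h1 _ r hr, h1 _ r hr]
    split_ifs <;> first | omega | simp

/-- Reality follows from the first bilinear relation alone: distinct pieces are orthogonal for the
Hermitian pairing, and on one piece the `(-1)^n` from the symmetry of `Q` matches `i^{2(p-q)}`. Only
positivity needs an openness argument. -/
theorem im_form_weil_eq_zero (hQs : ∀ u v, Q u v = (-1) ^ n * Q v u)
    {f : ℤ → Submodule ℂ (Complexification H)} (hf : Antitone f)
    (hf' : ∀ p : ℤ, ∀ u ∈ f p, ∀ v ∈ f (n - p + 1), complexForm Q u v = 0)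
    {u : ℕ → Complexification H}
    (hu : ∀ p ∈ Finset.range (n + 1), u p ∈ hodgePiece f p ((n : ℤ) - p)) :
    (complexForm Q (∑ p ∈ Finset.range (n + 1), Complex.I ^ ((p : ℤ) - ((n : ℤ) - p)) • u p)
      (complexConj H (∑ p ∈ Finset.range (n + 1), u p))).im = 0 := by
  have horth : ∀ p ∈ Finset.range (n + 1), ∀ q ∈ Finset.range (n + 1), p ≠ q →
      complexForm Q (u p) (complexConj H (u q)) = 0 := by
    intro p hp q hq hpq
    obtain ⟨hp1, vp, hvp, hvp'⟩ := hu p hp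
    obtain ⟨hq1, vq, hvq, hvq'⟩ := hu q hq
    rcases lt_or_gt_of_ne hpq with hlt | hlt
    · rw [← hvp', complexForm_conj, hf' ((n : ℤ) - p) vp hvp (u q) (hf (by omega) hq1), map_zero]
    · rw [← hvq', complexConj_complexConj]
      exact hf' p _ hp1 vq (hf (by omega) hvq)
  rw [map_sum, map_sum, LinearMap.sum_apply, ← Complex.conj_eq_iff_im, map_sum]
  refine Finset.sum_congr rfl fun p hp => ?_
  rw [map_sum, Finset.sum_eq_single_of_mem p hp fun q hq hqp => by
    rw [map_smul, LinearMap.smul_apply, horth p hp q hq hqp.symm, smul_zero]]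
  rw [map_smul, LinearMap.smul_apply, smul_eq_mul, map_mul, ← complexForm_conj,
    complexConj_complexConj, complexForm_symm Q n hQs, map_zpow₀, Complex.conj_I]
  have hI : (-Complex.I) = Complex.I⁻¹ := Complex.inv_I.symm
  rw [hI, inv_zpow, ← mul_assoc]
  congr 1
  have hk : Complex.I ^ ((p : ℤ) - ((n : ℤ) - p)) ≠ 0 := zpow_ne_zero _ Complex.I_ne_zero
  rw [inv_mul_eq_iff_eq_mul₀ hk, ← zpow_add₀ Complex.I_ne_zero,
    show (p : ℤ) - ((n : ℤ) - p) + ((p : ℤ) - ((n : ℤ) - p)) = 2 * ((2 * p : ℕ) - n) by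
      push_cast; ring, zpow_mul, zpow_ofNat, Complex.I_sq, zpow_sub₀ (by norm_num), zpow_natCast,
    zpow_natCast, pow_mul]
  simp only [neg_one_sq, one_pow, one_div]
  rw [← inv_pow]
  norm_num

variable [FiniteDimensional ℚ H]

theorem continuous_splitEnd (p : ℤ) : Continuous (F.splitEnd p) :=
  (continuous_id.mul continuous_const).add
    ((continuous_of_conjLinear (conjEnd H)).mul continuous_const)

theorem continuousAt_movedProj (p : ℤ) : ContinuousAt (F.movedProj p) 1 := by
  have h1 : ContinuousAt (F.splitEnd p) 1 := (F.continuous_splitEnd p).continuousAt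
  have h2 : ContinuousAt Ring.inverse (F.splitEnd p 1) := by
    rw [splitEnd_one]
    exact NormedRing.inverse_continuousAt (1 : (Module.End ℂ (Complexification H))ˣ)
  exact (h1.mul continuousAt_const).mul (h2.comp h1)

theorem eventually_isUnit_splitEnd : ∀ᶠ g in 𝓝 1, ∀ p, IsUnit (F.splitEnd p g) := by
  have h1 : ∀ p, ∀ᶠ g in 𝓝 1, IsUnit (F.splitEnd p g) := by
    intro p
    refine (F.continuous_splitEnd p).continuousAt.eventually_mem (s := {x | IsUnit x})
      (Units.isOpen.mem_nhds ?_)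
    rw [splitEnd_one]
    exact isUnit_one
  -- The filtration is constant for `p ≤ 0` and for `p ≥ n + 1`, so finitely many indices suffice.
  have h2 : ∀ᶠ g in 𝓝 1, ∀ p ∈ Finset.Icc (0 : ℤ) (n + 1), IsUnit (F.splitEnd p g) :=
    (Filter.eventually_all_finset _).2 fun p _ => h1 p
  filter_upwards [h2] with g hg p
  by_cases hp : p < 0
  · have e : F.splitEnd p g = F.splitEnd 0 g := by
      rw [splitEnd, splitEnd, F.filProj_of_nonpos hp.le, F.filProj_of_nonpos le_rfl]
    rw [e]
    exact hg 0 (by simp; omega)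
  · by_cases hp' : (n : ℤ) + 1 < p
    · have e : F.splitEnd p g = F.splitEnd (n + 1) g := by
        rw [splitEnd, splitEnd, F.filProj_of_gt (p := p) (by omega),
          F.filProj_of_gt (p := n + 1) (by omega)]
      rw [e]
      exact hg (n + 1) (by simp; omega)
    · exact hg p (by simp; omega)

/-- Positivity at `g = 1` is the second bilinear relation. It persists uniformly on the compact unit
sphere, and both sides scale by `‖u‖²`. -/
theorem eventually_form_movedWeil_pos : ∀ᶠ g in 𝓝 1, ∀ u : Complexification H, u ≠ 0 →
    0 < (complexForm Q (F.movedWeil g u) (complexConj H u)).re := by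
  have : ProperSpace (Complexification H) := FiniteDimensional.proper ℂ _
  have hone : ∀ p, IsUnit (F.splitEnd p 1) := fun p => by rw [splitEnd_one]; exact isUnit_one
  have hpos : ∀ u : Complexification H, u ≠ 0 →
      0 < (complexForm Q (F.movedWeil 1 u) (complexConj H u)).re := by
    intro u hu
    have hmap : (fun p => (F.fil p).map (1 : Module.End ℂ (Complexification H))) = F.fil :=
      funext fun p => Submodule.map_id _
    have hmem : ∀ p ∈ Finset.range (n + 1), F.pieceProj p u ∈ hodgePiece F.fil p ((n : ℤ) - p) :=
      fun p _ => F.pieceProj_apply_mem (by ring) u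
    have h1 := F.movedWeil_apply hone (u := fun p => F.pieceProj p u) (by rwa [hmap])
    have h2 := F.form_pos (fun p => F.pieceProj p u) hmem
    simp only [F.sum_pieceProj_apply] at h1 h2
    rw [h1]
    exact (h2 hu).1
  have hweil : ContinuousAt F.movedWeil 1 := by
    refine tendsto_finsetSum _ fun p _ => ?_
    exact ((F.continuousAt_movedProj _).sub (F.continuousAt_movedProj _)).const_smul
      (Complex.I ^ ((p : ℤ) - ((n : ℤ) - p)))
  have heval : Continuous fun p : Module.End ℂ (Complexification H) × Complexification H =>
      p.1 p.2 := continuous_bilinear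
        (LinearMap.id : Module.End ℂ (Complexification H) →ₗ[ℂ]
          (Complexification H →ₗ[ℂ] Complexification H))
  have hcont : ∀ u : Complexification H, ContinuousAt
      (fun p : Module.End ℂ (Complexification H) × Complexification H =>
        (complexForm Q (F.movedWeil p.1 p.2) (complexConj H p.2)).re) (1, u) := by
    intro u
    have h1 : ContinuousAt (fun p : Module.End ℂ (Complexification H) × Complexification H =>
        (F.movedWeil p.1, p.2)) (1, u) :=
      (ContinuousAt.comp (f := Prod.fst) (x := ((1 : Module.End ℂ (Complexification H)), u)) hweil
        continuousAt_fst).prodMk continuousAt_snd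
    have h2 := (heval.continuousAt (x := (F.movedWeil 1, u))).comp_of_eq h1 rfl
    have h3 : ContinuousAt (fun p : Module.End ℂ (Complexification H) × Complexification H =>
        complexConj H p.2) (1, u) :=
      (continuous_of_conjLinear (complexConj H)).continuousAt.comp continuousAt_snd
    have h4 := (continuous_bilinear (complexForm Q)).continuousAt.comp (h2.prodMk h3)
    exact Complex.continuous_re.continuousAt.comp h4
  have hK := (isCompact_sphere (0 : Complexification H) 1).eventually_forall_of_forall_eventually
    (x₀ := (1 : Module.End ℂ (Complexification H)))
    (P := fun g u => 0 < (complexForm Q (F.movedWeil g u) (complexConj H u)).re)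
    (fun u hu => (hcont u).eventually (lt_mem_nhds
      (hpos u (ne_zero_of_mem_sphere one_ne_zero ⟨u, hu⟩))))
  filter_upwards [hK] with g hg u hu
  have hu' : ‖u‖ ≠ 0 := norm_ne_zero_iff.2 hu
  have h1 := hg ((‖u‖⁻¹ : ℂ) • u) (by
    rw [mem_sphere_zero_iff_norm, norm_smul, norm_inv, Complex.norm_real, norm_norm,
      inv_mul_cancel₀ hu'])
  rw [map_smul, (complexConj H).map_smulₛₗ, map_smul, map_smul, LinearMap.smul_apply, smul_eq_mul,
    smul_eq_mul, map_inv₀, Complex.conj_ofReal, ← mul_assoc, ← Complex.ofReal_inv,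
    ← Complex.ofReal_mul, Complex.re_ofReal_mul] at h1
  exact pos_of_mul_pos_right h1 (by positivity)

/-- Gives `dim H^{p,q} = dim F^p - dim F^{p+1}`, so the Hodge numbers survive translation by an
invertible `g`. -/
theorem finrank_inf_eq_of_isCompl {V : Type*} [AddCommGroup V] [Module ℂ V]
    [FiniteDimensional ℂ V] {A A' B : Submodule ℂ V} (hA : A' ≤ A) (hB : IsCompl A' B) :
    Module.finrank ℂ (A ⊓ B : Submodule ℂ V) + Module.finrank ℂ A' = Module.finrank ℂ A := by
  have h1 := Submodule.finrank_sup_add_finrank_inf_eq A B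
  have h2 := Submodule.finrank_add_eq_of_isCompl hB
  have h3 : A ⊔ B = ⊤ := top_le_iff.1 (hB.sup_eq_top ▸ sup_le_sup_right hA B)
  rw [h3, finrank_top] at h1
  omega

/-- `D` is open: `g F` lies in `D` for `g ∈ G_ℂ` near `1`. -/
theorem eventually_exists_translate (hQs : ∀ u v, Q u v = (-1) ^ n * Q v u) :
    ∀ᶠ g : Module.End ℂ (Complexification H) in 𝓝 1,
      (∀ u v, complexForm Q (g u) (g v) = complexForm Q u v) →
      ∃ F' : PeriodDomain Q n h, ∀ p, F'.fil p = (F.fil p).map g := by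
  filter_upwards [F.eventually_isUnit_splitEnd, F.eventually_form_movedWeil_pos] with g hg hpos hgQ
  have hbij : Function.Bijective g := by
    have := hg 0
    rw [splitEnd, F.filProj_of_nonpos le_rfl, sub_self, mul_zero, add_zero, mul_one] at this
    exact (Module.End.isUnit_iff _).1 this
  have hanti : Antitone fun p => (F.fil p).map g :=
    fun p q hpq => Submodule.map_mono (F.antitone_fil hpq)
  have hform : ∀ p : ℤ, ∀ u ∈ (F.fil p).map g, ∀ v ∈ (F.fil (n - p + 1)).map g,
      complexForm Q u v = 0 := by
    rintro p _ ⟨u, hu, rfl⟩ _ ⟨v, hv, rfl⟩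
    rw [hgQ, F.form_eq_zero p u hu v hv]
  have hdim : ∀ p, Module.finrank ℂ ((F.fil p).map g) = Module.finrank ℂ (F.fil p) :=
    fun p => (Submodule.equivMapOfInjective g hbij.1 _).finrank_eq.symm
  refine ⟨{
    fil := fun p => (F.fil p).map g
    antitone_fil := hanti
    fil_zero := by rw [F.fil_zero, Submodule.map_top, LinearMap.range_eq_top.2 hbij.2]
    isCompl_fil := fun p => F.isCompl_map_of_isUnit (hg p)
    finrank_hodgePiece := ?_
    form_eq_zero := hform
    form_pos := ?_ }, fun p => rfl⟩
  · intro p q hpq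
    have hq : (q : ℤ) = n - (p + 1 : ℤ) + 1 := by omega
    have h1 := finrank_inf_eq_of_isCompl (F.antitone_fil (show (p : ℤ) ≤ p + 1 by omega))
      (F.isCompl_fil (p + 1))
    have h2 := finrank_inf_eq_of_isCompl (hanti (show (p : ℤ) ≤ p + 1 by omega))
      (F.isCompl_map_of_isUnit (hg (p + 1)))
    rw [← F.finrank_hodgePiece p q hpq, hodgePiece, hodgePiece, hq]
    simp only [hdim] at h2
    omega
  · intro u hu hu0
    refine ⟨?_, im_form_weil_eq_zero hQs hanti hform hu⟩
    rw [← F.movedWeil_apply hg hu]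
    exact hpos _ hu0

end PeriodDomain

/-! ### The complex group and differentials of maps to the period domain -/

section ComplexGroup

variable {H : Type*} [AddCommGroup H] [Module ℚ H]

/-- The group `G_ℂ` of automorphisms of the complexified form. -/
def complexGroup (Q : LinearMap.BilinForm ℚ H) : Set (Module.End ℂ (Complexification H)) :=
  {g | ∀ u v, complexForm Q (g u) (g v) = complexForm Q u v}

variable {Q : LinearMap.BilinForm ℚ H}

theorem one_mem_complexGroup : (1 : Module.End ℂ (Complexification H)) ∈ complexGroup Q :=
  fun _ _ => rfl

theorem mul_mem_complexGroup {g g' : Module.End ℂ (Complexification H)} (hg : g ∈ complexGroup Q)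
    (hg' : g' ∈ complexGroup Q) : g * g' ∈ complexGroup Q := fun u v => by
  rw [Module.End.mul_apply, Module.End.mul_apply, hg, hg']

variable [FiniteDimensional ℚ H]

theorem mem_complexGroup_iff (hQ : (complexForm Q).Nondegenerate)
    {g : Module.End ℂ (Complexification H)} :
    g ∈ complexGroup Q ↔ formAdjoint (complexForm Q) hQ g * g = 1 :=
  (formAdjoint_mul_self_eq_one_iff hQ).symm

theorem mul_formAdjoint_of_mem (hQ : (complexForm Q).Nondegenerate)
    {g : Module.End ℂ (Complexification H)} (hg : g ∈ complexGroup Q) :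
    g * formAdjoint (complexForm Q) hQ g = 1 :=
  mul_eq_one_comm.1 ((mem_complexGroup_iff hQ).1 hg)

theorem formAdjoint_mem_complexGroup (hQ : (complexForm Q).Nondegenerate)
    {g : Module.End ℂ (Complexification H)} (hg : g ∈ complexGroup Q) :
    formAdjoint (complexForm Q) hQ g ∈ complexGroup Q := fun u v => by
  rw [← hg, ← Module.End.mul_apply, ← Module.End.mul_apply, mul_formAdjoint_of_mem hQ hg,
    Module.End.one_apply, Module.End.one_apply]

theorem conj_mem_lieAlg (hQ : (complexForm Q).Nondegenerate)
    {g A : Module.End ℂ (Complexification H)} (hg : g ∈ complexGroup Q) (hA : A ∈ lieAlg Q) :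
    g * A * formAdjoint (complexForm Q) hQ g ∈ lieAlg Q := by
  intro u v
  have hg' : ∀ w, g (formAdjoint (complexForm Q) hQ g w) = w := fun w => by
    rw [← Module.End.mul_apply, mul_formAdjoint_of_mem hQ hg, Module.End.one_apply]
  have h1 := hA (formAdjoint (complexForm Q) hQ g u) (formAdjoint (complexForm Q) hQ g v)
  rw [← hg, ← hg (formAdjoint (complexForm Q) hQ g u), hg', hg'] at h1
  exact h1

/-- The adjoint as a continuous linear map. -/
def formAdjointL (hQ : (complexForm Q).Nondegenerate) :
    Module.End ℂ (Complexification H) →L[ℂ] Module.End ℂ (Complexification H) :=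
  LinearMap.toContinuousLinearMap (formAdjoint (complexForm Q) hQ)

theorem formAdjointL_apply (hQ : (complexForm Q).Nondegenerate)
    (A : Module.End ℂ (Complexification H)) :
    formAdjointL hQ A = formAdjoint (complexForm Q) hQ A := rfl

theorem exp_mem_complexGroup (hQ : (complexForm Q).Nondegenerate)
    {A : Module.End ℂ (Complexification H)} (hA : A ∈ lieAlg Q) :
    NormedSpace.exp A ∈ complexGroup Q := by
  rw [mem_complexGroup_iff hQ, ← formAdjointL_apply,
    map_exp_of_antimultiplicative _ (formAdjoint_mul hQ) (formAdjoint_one hQ), formAdjointL_apply,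
    (PeriodDomain.mem_lieAlg_iff hQ A).1 hA, exp_neg_mul_exp]

theorem exp_smul_mem_complexGroup (hQ : (complexForm Q).Nondegenerate)
    {A : Module.End ℂ (Complexification H)} (hA : A ∈ lieAlg Q) (t : ℂ) :
    NormedSpace.exp (t • A) ∈ complexGroup Q :=
  exp_mem_complexGroup hQ ((lieAlg Q).smul_mem t hA)

theorem nilpotentExp_eq_exp {A : Module.End ℂ (Complexification H)} (hA : IsNilpotent A) :
    IsNilpotent.exp A = NormedSpace.exp A := by
  obtain ⟨k, hk⟩ := hA
  rw [IsNilpotent.exp_eq_sum hk, NormedSpace.exp_eq_tsum ℂ]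
  simp only
  rw [tsum_eq_sum (s := Finset.range k)]
  · refine Finset.sum_congr rfl fun i _ => LinearMap.ext fun u => ?_
    rw [LinearMap.smul_apply, LinearMap.smul_apply,
      ← algebraMap_smul ℂ ((i.factorial : ℚ)⁻¹) ((A ^ i) u)]
    simp
  · intro i hi
    rw [pow_eq_zero_of_le (by simpa using hi) hk, smul_zero]

/-- An endomorphism valued function is differentiable if its matrix entries are. -/
theorem hasDerivAt_end {G : ℂ → Module.End ℂ (Complexification H)}
    {A : Module.End ℂ (Complexification H)} {t : ℂ}
    (hG : ∀ (u : Complexification H) (l : Module.Dual ℂ (Complexification H)),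
      HasDerivAt (fun s => l (G s u)) (l (A u)) t) : HasDerivAt G A t := by
  let b := Module.finBasis ℂ (Complexification H)
  let e : Module.End ℂ (Complexification H) ≃ₗ[ℂ] (_ → _ → ℂ) :=
    (LinearMap.toMatrix b b).trans (Matrix.ofLinearEquiv ℂ).symm
  have h1 : HasDerivAt (fun s => e (G s)) (e A) t := by
    refine hasDerivAt_pi.2 fun i => hasDerivAt_pi.2 fun j => ?_
    simpa [e, LinearMap.toMatrix_apply] using hG (b j) (b.coord i)
  have h2 := (LinearMap.toContinuousLinearMap e.symm.toLinearMap).hasFDerivAt.comp_hasDerivAt t h1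
  simpa [Function.comp_def] using h2

/-- The matrix entry `A ↦ l (A u)` as a continuous linear form. -/
def entryL (u : Complexification H) (l : Module.Dual ℂ (Complexification H)) :
    Module.End ℂ (Complexification H) →L[ℂ] ℂ :=
  LinearMap.toContinuousLinearMap (l ∘ₗ LinearMap.applyₗ u)

theorem entryL_apply (u : Complexification H) (l : Module.Dual ℂ (Complexification H))
    (A : Module.End ℂ (Complexification H)) : entryL u l A = l (A u) := rfl

/-- Turns membership in a subspace into vanishing of scalar functions, which can be differentiated
and summed. -/
theorem mem_of_forall_dual {V : Type*} [AddCommGroup V] [Module ℂ V] {S : Submodule ℂ V} {u : V}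
    (hu : ∀ l : Module.Dual ℂ V, (∀ v ∈ S, l v = 0) → l u = 0) : u ∈ S := by
  by_contra h0
  obtain ⟨l, hl, hl'⟩ := Submodule.exists_le_ker_of_notMem h0
  exact hl (hu l fun v hv => hl' hv)

/-- The derivative at `1` of a curve in `G_ℂ` lies in `𝒢_ℂ`. -/
theorem mem_lieAlg_of_hasDerivAt (hQ : (complexForm Q).Nondegenerate)
    {δ : ℂ → Module.End ℂ (Complexification H)} {B : Module.End ℂ (Complexification H)}
    (h0 : δ 0 = 1) (hδ : HasDerivAt δ B 0) (hG : ∀ᶠ t in 𝓝 0, δ t ∈ complexGroup Q) :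
    B ∈ lieAlg Q := by
  rw [PeriodDomain.mem_lieAlg_iff hQ]
  have h1 := ((formAdjointL hQ).hasFDerivAt.comp_hasDerivAt (0 : ℂ) hδ).mul hδ
  have h2 : (fun t => formAdjointL hQ (δ t) * δ t) =ᶠ[𝓝 0] fun _ => 1 :=
    hG.mono fun t ht => (mem_complexGroup_iff hQ).1 ht
  have h3 := h1.unique ((hasDerivAt_const (0 : ℂ) _).congr_of_eventuallyEq h2)
  simp only [Function.comp_apply, h0, mul_one] at h3
  rw [formAdjointL_apply, formAdjointL_apply, formAdjoint_one, one_mul] at h3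
  exact eq_neg_of_add_eq_zero_left h3

end ComplexGroup

namespace PeriodDomain

variable {H : Type*} [AddCommGroup H] [Module ℚ H] [FiniteDimensional ℚ H]
  {Q : LinearMap.BilinForm ℚ H} {n : ℕ} {h : ℕ → ℕ → ℕ}

theorem isHolomorphicAt_of_lift (hQ : (complexForm Q).Nondegenerate) {k : ℕ}
    {φ : (Fin k → ℂ) → PeriodDomain Q n h} {v : Fin k → ℂ}
    {g : (Fin k → ℂ) → Module.End ℂ (Complexification H)} (hg : AnalyticAt ℂ g v) (hgv : g v = 1)
    (hG : ∀ᶠ w in 𝓝 v, g w ∈ complexGroup Q)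
    (hφ : ∀ᶠ w in 𝓝 v, ∀ p, (φ w).fil p = ((φ v).fil p).map (g w)) : IsHolomorphicAt φ v := by
  have hd := hg.differentiableAt.hasFDerivAt
  have hmem : ∀ ξ, fderiv ℂ g v ξ ∈ lieAlg Q := by
    intro ξ
    have hline : HasDerivAt (fun t : ℂ => v + t • ξ) ξ 0 := by
      simpa using ((hasDerivAt_id (0 : ℂ)).smul_const ξ).const_add v
    refine mem_lieAlg_of_hasDerivAt hQ (δ := fun t => g (v + t • ξ)) (by simp [hgv]) ?_ ?_
    · exact HasFDerivAt.comp_hasDerivAt (0 : ℂ) (by simpa using hd) hline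
    · exact hline.continuousAt.eventually (p := fun w => g w ∈ complexGroup Q) (by simpa using hG)
  refine ⟨(φ v).stab.mkQ ∘ₗ (fderiv ℂ g v).toLinearMap.codRestrict _ hmem, g, fun u l => ?_, hgv,
    hG.and hφ, fun ξ => ⟨⟨_, hmem ξ⟩, rfl, fun u l => ?_⟩⟩
  · exact ((entryL u l).analyticAt _).comp hg
  · have h1 := ((entryL u l).hasFDerivAt.comp v hd).fderiv
    exact congrArg (fun f => f ξ) h1

/-- The differential of a holomorphic map on the velocity of a curve, computed from any lift of
the curve to `G_ℂ`. -/
theorem differential_apply_eq (hQ : (complexForm Q).Nondegenerate) {k : ℕ}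
    {φ : (Fin k → ℂ) → PeriodDomain Q n h} {v : Fin k → ℂ} (hφ : IsHolomorphicAt φ v)
    {γ : ℂ → Fin k → ℂ} {ξ : Fin k → ℂ} (hγ0 : γ 0 = v) (hγ : HasDerivAt γ ξ 0)
    {δ : ℂ → Module.End ℂ (Complexification H)} {B : lieAlg Q} (hδ0 : δ 0 = 1)
    (hδ : HasDerivAt δ B.1 0) (hG : ∀ᶠ t in 𝓝 0, δ t ∈ complexGroup Q)
    (hfil : ∀ᶠ t in 𝓝 0, ∀ p, (φ (γ t)).fil p = ((φ v).fil p).map (δ t)) :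
    differential φ v ξ = (φ v).stab.mkQ B := by
  rw [differential, dif_pos hφ]
  obtain ⟨g, hga, hgv, hgG, hgd⟩ := hφ.choose_spec
  obtain ⟨A, hA, hA'⟩ := hgd ξ
  rw [hA, Submodule.mkQ_apply, Submodule.mkQ_apply, Submodule.Quotient.eq]
  have hgγ : HasDerivAt (fun t => g (γ t)) A.1 0 := by
    refine hasDerivAt_end fun u l => ?_
    have h1 := (hga u l).differentiableAt.hasFDerivAt
    rw [← hA' u l]
    rw [← hγ0] at h1 ⊢
    exact h1.comp_hasDerivAt (0 : ℂ) hγ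
  -- `δ⁻¹ (g ∘ γ)` is a curve in the stabilizer of the filtration `φ v`, with the adjoint serving as
  -- inverse. Its derivative `A - B` at `0` therefore lies in the stabilizer algebra.
  have hprod := ((formAdjointL hQ).hasFDerivAt.comp_hasDerivAt (0 : ℂ) hδ).mul hgγ
  have hderiv : HasDerivAt (fun t => formAdjointL hQ (δ t) * g (γ t)) (A.1 - B.1) 0 := by
    refine hprod.congr_deriv ?_
    simp only [Function.comp_apply, hδ0, hγ0, hgv, mul_one]
    rw [formAdjointL_apply, formAdjointL_apply, formAdjoint_one, one_mul,
      (mem_lieAlg_iff hQ _).1 B.2]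
    abel
  intro p u hu
  refine mem_of_forall_dual fun l hl => ?_
  have h1 := (entryL u l).hasFDerivAt.comp_hasDerivAt (0 : ℂ) hderiv
  have hγc : Filter.Tendsto γ (𝓝 0) (𝓝 v) := hγ0 ▸ hγ.continuousAt
  have h2 : (fun t => entryL u l (formAdjointL hQ (δ t) * g (γ t))) =ᶠ[𝓝 0] fun _ => 0 := by
    filter_upwards [hG, hfil, hγc.eventually hgG] with t ht hfilt hgt
    have h3 : g (γ t) u ∈ ((φ v).fil p).map (δ t) := by
      rw [← hfilt p, hgt.2 p]
      exact Submodule.mem_map_of_mem hu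
    obtain ⟨w, hw, hw'⟩ := h3
    rw [entryL_apply, Module.End.mul_apply, ← hw', formAdjointL_apply, ← Module.End.mul_apply,
      (mem_complexGroup_iff hQ).1 ht, Module.End.one_apply]
    exact hl w hw
  exact h1.unique ((hasDerivAt_const (0 : ℂ) _).congr_of_eventuallyEq h2)

/-! ### The local parametrization -/

variable (F : PeriodDomain Q n h)

/-- `F.coord` as a continuous linear map. -/
def coordL : (Fin F.dim → ℂ) →L[ℂ] Module.End ℂ (Complexification H) :=
  LinearMap.toContinuousLinearMap
    (F.compl.subtype ∘ₗ (Module.finBasis ℂ F.compl).equivFun.symm.toLinearMap)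

theorem coordL_apply (x : Fin F.dim → ℂ) : F.coordL x = F.coord x := rfl

theorem coord_mem_compl (x : Fin F.dim → ℂ) : F.coord x ∈ F.compl := Subtype.mem _

theorem exists_coord_eq {A : Module.End ℂ (Complexification H)} (hA : A ∈ F.compl) :
    ∃ x, F.coord x = A :=
  ⟨(Module.finBasis ℂ F.compl).equivFun ⟨A, hA⟩, by rw [coord, LinearEquiv.symm_apply_apply]⟩

theorem exists_coord_leftInverse :
    ∃ κ : Module.End ℂ (Complexification H) →L[ℂ] (Fin F.dim → ℂ), ∀ x, κ (F.coord x) = x := by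
  have hinj : LinearMap.ker (F.compl.subtype ∘ₗ
      (Module.finBasis ℂ F.compl).equivFun.symm.toLinearMap) = ⊥ :=
    LinearMap.ker_eq_bot.2 (F.compl.injective_subtype.comp (LinearEquiv.injective _))
  obtain ⟨κ, hκ⟩ := LinearMap.exists_leftInverse_of_injective _ hinj
  exact ⟨LinearMap.toContinuousLinearMap κ, fun x => LinearMap.congr_fun hκ x⟩

theorem tendsto_exp_coord :
    Filter.Tendsto (fun x => NormedSpace.exp (F.coord x)) (𝓝 0) (𝓝 1) := by
  have h1 : Continuous fun x => NormedSpace.exp (F.coordL x) :=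
    continuous_exp_banach.comp F.coordL.continuous
  have h2 := h1.tendsto 0
  rwa [map_zero, NormedSpace.exp_zero] at h2

theorem exp_coord_mem_complexGroup (hQ : (complexForm Q).Nondegenerate) (x : Fin F.dim → ℂ) :
    NormedSpace.exp (F.coord x) ∈ complexGroup Q :=
  exp_mem_complexGroup hQ (F.compl_le_lieAlg (F.coord_mem_compl x))

/-- By openness of `D`, the default value in `chart` does not occur near `0`. -/
theorem eventually_chart_fil (hQ : (complexForm Q).Nondegenerate)
    (hQs : ∀ u v, Q u v = (-1) ^ n * Q v u) :
    ∀ᶠ x in 𝓝 0, ∀ p, (F.chart x).fil p = (F.fil p).map (NormedSpace.exp (F.coord x)) := by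
  filter_upwards [F.tendsto_exp_coord.eventually (F.eventually_exists_translate hQs)] with x hx
  obtain ⟨F', hF'⟩ := hx (F.exp_coord_mem_complexGroup hQ x)
  rw [← nilpotentExp_eq_exp (F.isNilpotent_of_mem_compl (F.coord_mem_compl x))] at hF' ⊢
  have hex : ∃ F' : PeriodDomain Q n h,
      ∀ p, F'.fil p = (F.fil p).map (IsNilpotent.exp (F.coord x)) := ⟨F', hF'⟩
  rw [chart, dif_pos hex]
  exact hex.choose_spec

theorem eventually_isHolomorphicAt_chart (hQ : (complexForm Q).Nondegenerate)
    (hQs : ∀ u v, Q u v = (-1) ^ n * Q v u) : ∀ᶠ x in 𝓝 0, IsHolomorphicAt F.chart x := by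
  filter_upwards [(F.eventually_chart_fil hQ hQs).eventually_nhds] with x hx
  have hneg : ∀ w, NormedSpace.exp (-F.coord w) ∈ complexGroup Q := fun w =>
    exp_mem_complexGroup hQ (neg_mem (F.compl_le_lieAlg (F.coord_mem_compl w)))
  refine isHolomorphicAt_of_lift hQ
    (g := fun w => NormedSpace.exp (F.coord w) * NormedSpace.exp (-F.coord x)) ?_
    (exp_mul_exp_neg _) ?_ ?_
  · have h1 : AnalyticAt ℂ (fun w => NormedSpace.exp (F.coordL w)) x :=
      (NormedSpace.exp_analytic (𝕂 := ℂ) _).comp (F.coordL.analyticAt x)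
    exact h1.mul analyticAt_const
  · exact .of_forall fun w => mul_mem_complexGroup (F.exp_coord_mem_complexGroup hQ w) (hneg x)
  · filter_upwards [hx] with w hw p
    rw [hw p, hx.self_of_nhds p, ← Submodule.map_comp, ← Module.End.mul_eq_comp, mul_assoc,
      exp_neg_mul_exp, mul_one]

theorem exp_apply_mem {S : Submodule ℂ (Complexification H)}
    {A : Module.End ℂ (Complexification H)} (hA : ∀ u ∈ S, A u ∈ S) {u : Complexification H}
    (hu : u ∈ S) : NormedSpace.exp A u ∈ S := by
  refine mem_of_forall_dual fun l hl => ?_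
  have h1 := (entryL u l).hasSum (NormedSpace.exp_series_hasSum_exp' (𝕂 := ℂ) A)
  have h2 : ∀ k : ℕ, ∀ u ∈ S, (A ^ k) u ∈ S := by
    intro k
    induction k with
    | zero => intro u hu; simpa using hu
    | succ k ih => intro u hu; rw [pow_succ, Module.End.mul_apply]; exact ih _ (hA u hu)
  have h3 : ∀ k : ℕ, entryL u l ((k.factorial : ℂ)⁻¹ • A ^ k) = 0 := by
    intro k
    rw [map_smul, entryL_apply, hl _ (h2 k u hu), smul_zero]
  simp only [h3] at h1
  exact h1.unique hasSum_zero

theorem map_exp_fil {A : Module.End ℂ (Complexification H)}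
    (hA : F.degreePart (· < 0) A = 0) (p : ℤ) : (F.fil p).map (NormedSpace.exp A) = F.fil p := by
  classical
  have h0 : ∀ p, ∀ u ∈ F.fil p, A u ∈ F.fil p := by
    have := (F.forall_fil_iff 0 A).2 fun a b hab => by
      have h1 := F.block_degreePart (· < 0) A a b
      rw [hA, if_pos (by omega)] at h1
      simpa using h1.symm
    simpa only [add_zero] using this
  refine le_antisymm ?_ fun u hu => ?_
  · rintro _ ⟨u, hu, rfl⟩
    exact exp_apply_mem (h0 p) hu
  · refine ⟨NormedSpace.exp (-A) u, exp_apply_mem (fun v hv => ?_) hu, ?_⟩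
    · exact neg_mem (h0 p v hv)
    · rw [← Module.End.mul_apply, exp_mul_exp_neg, Module.End.one_apply]

/-- Holomorphic local coordinates on `G_ℂ · F`, lifted to a neighbourhood of `1` in `End H_ℂ`. -/
theorem exists_coordinates (hQ : (complexForm Q).Nondegenerate)
    (hQs : ∀ u v, Q u v = (-1) ^ n * Q v u) :
    ∃ C : Module.End ℂ (Complexification H) → Fin F.dim → ℂ, ContDiffAt ℂ ω C 1 ∧ C 1 = 0 ∧
      (∀ᶠ g in 𝓝 1, g ∈ complexGroup Q → ∀ p, (F.chart (C g)).fil p = (F.fil p).map g) ∧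
      ∀ᶠ x in 𝓝 0, C (NormedSpace.exp (F.coord x)) = x := by
  obtain ⟨κ, hκ⟩ := F.exists_coord_leftInverse
  -- Take `π` to be the negative part and `σ` the adjoint. Then `g = exp (c g) * exp b` with `b` of
  -- nonnegative degree, so `exp b` fixes `F` and `g F = exp (c g) F`; for `g ∈ G_ℂ`, `c g` lies in
  -- `𝔭`.
  obtain ⟨c, hc, hc1, hcg, hcm⟩ := exists_local_triangular_decomposition
    (LinearMap.toContinuousLinearMap (F.degreePart (· < 0))) (formAdjointL hQ)
    (F.degreePart_degreePart _) (formAdjoint_mul hQ) (formAdjoint_one hQ)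
    (F.degreePart_formAdjoint hQ _)
  have hC : ContDiffAt ℂ ω (fun g => κ (c g)) 1 := κ.contDiff.contDiffAt.comp _ hc
  refine ⟨fun g => κ (c g), hC, by simp [hc1], ?_, ?_⟩
  · have hlim : Filter.Tendsto (fun g => κ (c g)) (𝓝 1) (𝓝 0) := by
      have := hC.continuousAt.tendsto
      rwa [hc1, map_zero] at this
    filter_upwards [hcg, hlim.eventually (F.eventually_chart_fil hQ hQs)] with g hg hchart hgG p
    obtain ⟨hcc, b, hb, hgb, hgl⟩ := hg
    have hmem : c g ∈ F.compl := by
      rw [← hcc]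
      exact F.degreePart_mem_compl hQ
        ((mem_lieAlg_iff hQ _).2 (hgl ((mem_complexGroup_iff hQ).1 hgG)))
    obtain ⟨x, hx⟩ := F.exists_coord_eq hmem
    rw [hchart p, ← hx, hκ, hx]
    conv_rhs => rw [hgb, Module.End.mul_eq_comp, Submodule.map_comp, F.map_exp_fil hb]
  · have hlim : Filter.Tendsto F.coord (𝓝 0) (𝓝 0) := by
      have := F.coordL.continuous.tendsto 0
      rwa [map_zero] at this
    filter_upwards [hlim.eventually hcm] with x hx
    rw [hx (F.degreePart_eq_self_of_mem_compl (F.coord_mem_compl x)), hκ]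

end PeriodDomain

/-- The first summand is symmetric as a second derivative, so after antisymmetrization only the
pullback of `dθ` remains: `d` commutes with pullback. -/
theorem hasFDerivAt_pullback_form {E X Y : Type*} [NormedAddCommGroup E] [NormedSpace ℂ E]
    [NormedAddCommGroup X] [NormedSpace ℂ X] [NormedAddCommGroup Y] [NormedSpace ℂ Y]
    {θ : X → X →L[ℂ] Y} {C : E → X} {g : E} (hC : ContDiffAt ℂ ω C g)
    (hθ : DifferentiableAt ℂ θ (C g)) :
    HasFDerivAt (fun g => (θ (C g)).comp (fderiv ℂ C g))
      ((ContinuousLinearMap.compL ℂ E X Y (θ (C g))).comp (fderiv ℂ (fderiv ℂ C) g) +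
        ((ContinuousLinearMap.compL ℂ E X Y).flip (fderiv ℂ C g)).comp
          ((fderiv ℂ θ (C g)).comp (fderiv ℂ C g))) g := by
  have h1 := (hC.differentiableAt (by simp)).hasFDerivAt
  have h2 : DifferentiableAt ℂ (fderiv ℂ C) g :=
    (hC.fderiv_right (m := ω) (by simp)).differentiableAt (by simp)
  exact (hθ.hasFDerivAt.comp g h1).clm_comp h2.hasFDerivAt

/-! ### Pullback to the group, and the absence of integrable subsystems -/

namespace PeriodDomain

variable {H : Type*} [AddCommGroup H] [Module ℚ H] [FiniteDimensional ℚ H]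
  {Q : LinearMap.BilinForm ℚ H} {n : ℕ} {h : ℕ → ℕ → ℕ} (F : PeriodDomain Q n h)

/-- Forms on `G_ℂ` near `1` that vanish on the left invariant fields of `𝒢^{-1,1}`, and whose
exterior derivatives vanish on pairs of left invariant fields that they annihilate, vanish on the
left invariant fields of the negative part of `𝒢_ℂ`. -/
theorem eventually_form_eq_zero_of_mem_compl (hh : ∀ p q, p + q = n → h p q ≠ 0)
    (hQ : (complexForm Q).Nondegenerate) (hQs : ∀ u v, Q u v = (-1) ^ n * Q v u)
    {𝕜 : Type*} [RCLike 𝕜] [NormedAlgebra 𝕜 (Module.End ℂ (Complexification H))]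
    {Y : Type*} [NormedAddCommGroup Y] [NormedSpace 𝕜 Y] {ι : Type*} [Finite ι]
    (hexp : ∀ X ∈ lieAlg Q, ∀ t : 𝕜, NormedSpace.exp (t • X) ∈ complexGroup Q)
    (Ω : ι → Module.End ℂ (Complexification H) → Module.End ℂ (Complexification H) →L[𝕜] Y)
    (hΩ : ∀ᶠ g in 𝓝 1, ∀ i, DifferentiableAt 𝕜 (Ω i) g)
    (hgr : ∀ X ∈ F.gr (-1), ∀ᶠ g in 𝓝 1, g ∈ complexGroup Q → ∀ i, Ω i g (g * X.1) = 0)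
    (hd : ∀ᶠ g in 𝓝 1, ∀ u v, (∀ i, Ω i g u = 0) → (∀ i, Ω i g v = 0) →
      ∀ i, fderiv 𝕜 (Ω i) g u v = fderiv 𝕜 (Ω i) g v u)
    {A : Module.End ℂ (Complexification H)} (hA : A ∈ F.compl) :
    ∀ᶠ g in 𝓝 1, g ∈ complexGroup Q → ∀ i, Ω i g (g * A) = 0 := by
  -- The elements whose left invariant fields are annihilated near `1`; the neighbourhood may depend
  -- on the element.
  let K : AddSubgroup (Module.End ℂ (Complexification H)) :=
    { carrier := {A | ∀ᶠ g in 𝓝 1, g ∈ complexGroup Q → ∀ i, Ω i g (g * A) = 0}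
      zero_mem' := .of_forall fun g _ i => by rw [mul_zero, map_zero]
      add_mem' := fun ha hb => by
        filter_upwards [ha, hb] with g ha hb hg i
        rw [mul_add, map_add, ha hg, hb hg, add_zero]
      neg_mem' := fun ha => by
        filter_upwards [ha] with g ha hg i
        rw [mul_neg, map_neg, ha hg, neg_zero] }
  refine F.compl_le_of_bracket_closed hh hQ hQs K hgr (fun X hX A hA hAK => ?_) hA
  exact eventually_form_commutator_eq_zero (complexGroup Q) X.1 A
    (fun g hg t => mul_mem_complexGroup hg (hexp _ X.2 t))
    (fun g hg t => mul_mem_complexGroup hg (hexp _ hA t)) Ω hΩ (hgr X hX) hAK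
    (hd.mono fun g hg _ => hg _ _)

/-- The conjugate `g A g⁻¹` of `A ∈ 𝒢_ℂ` by `g ∈ G_ℂ`. -/
def adLie (hQ : (complexForm Q).Nondegenerate) {g : Module.End ℂ (Complexification H)}
    (hg : g ∈ complexGroup Q) (A : lieAlg Q) : lieAlg Q :=
  ⟨g * A.1 * formAdjoint (complexForm Q) hQ g, conj_mem_lieAlg hQ hg A.2⟩

theorem adLie_mul (hQ : (complexForm Q).Nondegenerate) {g : Module.End ℂ (Complexification H)}
    (hg : g ∈ complexGroup Q) (A : lieAlg Q) : (adLie hQ hg A).1 * g = g * A.1 := by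
  rw [adLie, mul_assoc, (mem_complexGroup_iff hQ).1 hg, mul_one]

/-- Conjugation by `g ∈ G_ℂ` need not respect the Hodge decompositions of `F` and `g F`, but it
respects the filtrations, and horizontality depends only on shifting the filtration by at most one.
-/
theorem mkQ_adLie_mem_horizontal (hQ : (complexForm Q).Nondegenerate)
    {g : Module.End ℂ (Complexification H)} (hg : g ∈ complexGroup Q) {A : lieAlg Q}
    (hA : A ∈ F.gr (-1)) {F' : PeriodDomain Q n h} (hF' : ∀ p, F'.fil p = (F.fil p).map g) :
    F'.stab.mkQ (adLie hQ hg A) ∈ F'.horizontal := by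
  refine F'.mkQ_mem_horizontal hQ _ fun p u hu => ?_
  rw [hF'] at hu ⊢
  obtain ⟨w, hw, rfl⟩ := hu
  rw [← Module.End.mul_apply, adLie_mul]
  exact Submodule.mem_map_of_mem (F.fil_sub_one_of_mem_gr hA p w hw)

theorem adLie_notMem_stab (hQ : (complexForm Q).Nondegenerate)
    {g : Module.End ℂ (Complexification H)} (hg : g ∈ complexGroup Q) {A : lieAlg Q}
    (hA : A ∈ F.gr (-1)) (hA0 : A ≠ 0) {F' : PeriodDomain Q n h}
    (hF' : ∀ p, F'.fil p = (F.fil p).map g) : adLie hQ hg A ∉ F'.stab := by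
  refine fun hst => hA0 (F.eq_zero_of_mem_gr_of_mem_stab hA fun p u hu => ?_)
  have h1 := hst p (g u) (by rw [hF']; exact Submodule.mem_map_of_mem hu)
  rw [← Module.End.mul_apply, adLie_mul, hF'] at h1
  obtain ⟨w, hw, hw'⟩ := h1
  have h2 := congrArg (formAdjoint (complexForm Q) hQ g) hw'
  rw [Module.End.mul_apply, ← Module.End.mul_apply, ← Module.End.mul_apply _ g,
    (mem_complexGroup_iff hQ).1 hg, Module.End.one_apply, Module.End.one_apply] at h2
  exact h2 ▸ hw

theorem hasDerivAt_mul_exp_mul (g g' A : Module.End ℂ (Complexification H)) (z : ℂ) :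
    HasDerivAt (fun t : ℂ => g * NormedSpace.exp ((t * z) • A) * g') (z • (g * A * g')) 0 := by
  have h1 := ((hasDerivAt_exp_smul_const (z • A) (0 : ℂ)).const_mul g).mul_const g'
  simp only [smul_smul] at h1
  simpa using h1

theorem hasDerivAt_mul_exp (g A : Module.End ℂ (Complexification H)) :
    HasDerivAt (fun t : ℂ => g * NormedSpace.exp (t • A)) (g * A) 0 := by
  simpa using (hasDerivAt_exp_smul_const A (0 : ℂ)).const_mul g

theorem chart_zero (hQ : (complexForm Q).Nondegenerate)
    (hQs : ∀ u v, Q u v = (-1) ^ n * Q v u) : F.chart 0 = F := by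
  refine PeriodDomain.ext (funext fun p => ?_)
  rw [(F.eventually_chart_fil hQ hQs).self_of_nhds p, ← coordL_apply, map_zero,
    NormedSpace.exp_zero]
  exact Submodule.map_id _

/-- `chart ∘ C` is the orbit map `g ↦ g F`, and `g exp(tA) = (g exp(tA) g⁻¹) g`, so the left
invariant field of `A` maps to the class of `g A g⁻¹`. -/
theorem eventually_differential_chart (hQ : (complexForm Q).Nondegenerate)
    (hQs : ∀ u v, Q u v = (-1) ^ n * Q v u)
    {C : Module.End ℂ (Complexification H) → Fin F.dim → ℂ} (hC : ContDiffAt ℂ ω C 1)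
    (hC1 : C 1 = 0)
    (hCF : ∀ᶠ g in 𝓝 1, g ∈ complexGroup Q → ∀ p, (F.chart (C g)).fil p = (F.fil p).map g) :
    ∀ᶠ g in 𝓝 1, ∀ hg : g ∈ complexGroup Q, ∀ A : lieAlg Q,
      differential F.chart (C g) (fderiv ℂ C g (g * A.1)) =
        (F.chart (C g)).stab.mkQ (adLie hQ hg A) := by
  have hlim : Filter.Tendsto C (𝓝 1) (𝓝 0) := hC1 ▸ hC.continuousAt
  filter_upwards [hlim.eventually (F.eventually_isHolomorphicAt_chart hQ hQs), hCF.eventually_nhds,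
    hC.eventually (by simp)] with g hhol hCF hCg hg A
  have hcurve := hasDerivAt_mul_exp g A.1
  have h0 : g * NormedSpace.exp ((0 : ℂ) • A.1) = g := by simp
  have hCd : HasFDerivAt C (fderiv ℂ C g) (g * NormedSpace.exp ((0 : ℂ) • A.1)) := by
    rw [h0]; exact (hCg.differentiableAt (by simp)).hasFDerivAt
  refine differential_apply_eq hQ hhol (γ := fun t => C (g * NormedSpace.exp (t • A.1)))
    (by rw [h0]) (hCd.comp_hasDerivAt (0 : ℂ) hcurve)
    (δ := fun t => g * NormedSpace.exp (t • A.1) * formAdjoint (complexForm Q) hQ g) ?_ ?_ ?_ ?_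
  · rw [h0, mul_formAdjoint_of_mem hQ hg]
  · exact hcurve.mul_const _
  · exact .of_forall fun t => mul_mem_complexGroup
      (mul_mem_complexGroup hg (exp_smul_mem_complexGroup hQ A.2 t))
      (formAdjoint_mem_complexGroup hQ hg)
  · have hc : Filter.Tendsto (fun t : ℂ => g * NormedSpace.exp (t • A.1)) (𝓝 0) (𝓝 g) := by
      have := hcurve.continuousAt.tendsto
      rwa [h0] at this
    filter_upwards [hc.eventually hCF] with t ht p
    rw [ht (mul_mem_complexGroup hg (exp_smul_mem_complexGroup hQ A.2 t)), hCF.self_of_nhds hg,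
      ← Submodule.map_comp, ← Module.End.mul_eq_comp, mul_assoc, (mem_complexGroup_iff hQ).1 hg,
      mul_one]

theorem fderiv_coordinates_apply
    {C : Module.End ℂ (Complexification H) → Fin F.dim → ℂ} (hC : ContDiffAt ℂ ω C 1)
    (hCx : ∀ᶠ x in 𝓝 0, C (NormedSpace.exp (F.coord x)) = x) (x : Fin F.dim → ℂ) :
    fderiv ℂ C 1 (F.coord x) = x := by
  have hcurve : HasDerivAt (fun t : ℂ => NormedSpace.exp (t • F.coord x)) (F.coord x) 0 := by
    simpa using hasDerivAt_mul_exp 1 (F.coord x)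
  have hCd : HasFDerivAt C (fderiv ℂ C 1) (NormedSpace.exp ((0 : ℂ) • F.coord x)) := by
    rw [zero_smul, NormedSpace.exp_zero]; exact (hC.differentiableAt (by simp)).hasFDerivAt
  have h1 := hCd.comp_hasDerivAt (0 : ℂ) hcurve
  have hline : HasDerivAt (fun t : ℂ => t • x) x 0 := by
    simpa using (hasDerivAt_id (0 : ℂ)).smul_const x
  have hlim : Filter.Tendsto (fun t : ℂ => t • x) (𝓝 0) (𝓝 0) := by
    have := hline.continuousAt.tendsto
    rwa [zero_smul] at this
  refine h1.unique (hline.congr_of_eventuallyEq ?_)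
  filter_upwards [hlim.eventually hCx] with t ht
  rw [← coordL_apply, map_smul] at ht
  exact ht

theorem extDerivOneForm_apply_eq_zero {N : ℕ} {P : Submodule ℂ ((Fin N → ℂ) →L[ℂ] ℂ)}
    {η : (Fin N → ℂ) →L[ℂ] (Fin N → ℂ) →L[ℂ] ℂ}
    (hη : η ∈ Submodule.span ℂ {η | ∃ α ∈ P, ∃ β, η = wedge α β}) {x y : Fin N → ℂ}
    (hx : ∀ α ∈ P, α x = 0) (hy : ∀ α ∈ P, α y = 0) : η x y = 0 := by
  induction hη using Submodule.span_induction with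
  | mem η hη =>
    obtain ⟨α, hα, β, rfl⟩ := hη
    simp [wedge, hx α hα, hy α hα]
  | zero => simp
  | add η η' _ _ h1 h2 => simp [h1, h2]
  | smul c η _ h1 => simp [h1]

/-- The infinitesimal period relation has no nonzero completely integrable subsystem. -/
theorem eq_bot_of_completelyIntegrable (hh : ∀ p q, p + q = n → h p q ≠ 0)
    (hQ : (complexForm Q).Nondegenerate) (hQs : ∀ u v, Q u v = (-1) ^ n * Q v u)
    {U : Set (PeriodDomain Q n h)} (hU : IsOpen U)
    {J : ∀ F : PeriodDomain Q n h, Submodule ℂ (Module.Dual ℂ F.Tangent)}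
    (hJ : IsPfaffianSystemOn J U) (hJI : ∀ F ∈ U, J F ≤ F.periodRelation)
    (hJU : IsCompletelyIntegrableOn J U) (hF : F ∈ U) : J F = ⊥ := by
  obtain ⟨r, θ, hθa, hθ⟩ := hJ F hF
  obtain ⟨C, hC, hC1, hCF, hCx⟩ := F.exists_coordinates hQ hQs
  have hlim : Filter.Tendsto C (𝓝 1) (𝓝 0) := hC1 ▸ hC.continuousAt
  have hdiff := F.eventually_differential_chart hQ hQs hC hC1 hCF
  have hθmem : ∀ᶠ x in 𝓝 0, ∀ i, θ i x ∈ pullback J F.chart x :=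
    hθ.mono fun x hx i => hx.2 ▸ Submodule.subset_span ⟨i, rfl⟩
  have hint : ∀ᶠ x in 𝓝 0, ∀ i, extDerivOneForm (θ i) x ∈
      Submodule.span ℂ {η | ∃ α ∈ pullback J F.chart x, ∃ β, η = wedge α β} :=
    Filter.eventually_all.2 fun i => hJU F hF (θ i) (hθa i) (hθmem.mono fun x hx => hx i)
  have hθd : ∀ᶠ x in 𝓝 0, ∀ i, DifferentiableAt ℂ (θ i) x :=
    Filter.eventually_all.2 fun i =>
      (hθa i).eventually_analyticAt.mono fun x hx => hx.differentiableAt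
  have hCe := hC.eventually (by simp)
  have hvan : ∀ A ∈ F.compl, ∀ᶠ g in 𝓝 1, g ∈ complexGroup Q →
      ∀ i, ((θ i (C g)).comp (fderiv ℂ C g)) (g * A) = 0 := by
    intro A hA
    refine F.eventually_form_eq_zero_of_mem_compl hh hQ hQs
      (fun X hX t => exp_smul_mem_complexGroup hQ hX t)
      (fun i g => (θ i (C g)).comp (fderiv ℂ C g)) ?_ ?_ ?_ hA
    · filter_upwards [hCe, hlim.eventually hθd] with g hCg hθg i
      exact (hasFDerivAt_pullback_form hCg (hθg i)).differentiableAt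
    · intro X hX
      filter_upwards [hdiff, hCF, hlim.eventually hθmem, hlim.eventually (hU F hF)]
        with g hdiff hCF hθg hUg hg i
      obtain ⟨_, ⟨l, hl, rfl⟩, hli⟩ := hθg i
      rw [ContinuousLinearMap.comp_apply, ← hli]
      change l (differential F.chart (C g) (fderiv ℂ C g (g * X.1))) = 0
      rw [hdiff hg X]
      exact (Submodule.mem_dualAnnihilator l).1 (hJI _ hUg hl) _
        (F.mkQ_adLie_mem_horizontal hQ hg hX (hCF hg))
    · filter_upwards [hCe, hlim.eventually hθd, hlim.eventually hint, hlim.eventually hθ]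
        with g hCg hθg hintg hθspan u v hu hv i
      have hsymm := hCg.isSymmSndFDerivAt_of_omega.eq u v
      -- The `θ i` span the pulled back `J`, so a vector killed by all of them is killed by every
      -- `α` in `J ∧ T^*`.
      have hann : ∀ w, (∀ i, ((θ i (C g)).comp (fderiv ℂ C g)) w = 0) →
          ∀ α ∈ pullback J F.chart (C g), α (fderiv ℂ C g w) = 0 := by
        intro w hw α hα
        rw [← hθspan.2] at hα
        induction hα using Submodule.span_induction with
        | mem α hα => obtain ⟨i, rfl⟩ := hα; exact hw i
        | zero => simp
        | add α β _ _ h1 h2 => simp [h1, h2]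
        | smul c α _ h1 => simp [h1]
      have h0 := extDerivOneForm_apply_eq_zero (hintg i) (hann u hu) (hann v hv)
      rw [extDerivOneForm, sub_apply, sub_apply,
        ContinuousLinearMap.flip_apply, sub_eq_zero] at h0
      rw [(hasFDerivAt_pullback_form hCg (hθg i)).fderiv]
      simp [hsymm, h0]
  -- At `g = 1` the derivative of `C` inverts the linear coordinates, so the vectors of `𝔭` map onto
  -- the whole coordinate space. The frame vanishes at `0` and must be empty.
  have hθ0 : ∀ i, θ i 0 = 0 := by
    intro i
    ext1 x
    have h1 := (hvan _ (F.coord_mem_compl x)).self_of_nhds one_mem_complexGroup i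
    rwa [ContinuousLinearMap.comp_apply, one_mul, F.fderiv_coordinates_apply hC hCx, hC1] at h1
  have hr : IsEmpty (Fin r) := ⟨fun i => hθ.self_of_nhds.1.ne_zero i (hθ0 i)⟩
  have hpull : pullback J F.chart 0 = ⊥ := by
    rw [← hθ.self_of_nhds.2, Set.range_eq_empty, Submodule.span_empty]
  -- Pulling back by the chart loses nothing, since its differential at `0` is onto.
  have hJ0 : J (F.chart 0) = ⊥ := by
    refine (Submodule.eq_bot_iff _).2 fun l hl => ?_
    have h1 : LinearMap.toContinuousLinearMap ((differential F.chart 0).dualMap l) ∈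
        pullback J F.chart 0 := ⟨_, ⟨l, hl, rfl⟩, rfl⟩
    rw [hpull, Submodule.mem_bot, LinearEquiv.map_eq_zero_iff] at h1
    refine LinearMap.ext fun v => ?_
    obtain ⟨A, rfl⟩ := Submodule.mkQ_surjective _ v
    have h2 := hdiff.self_of_nhds one_mem_complexGroup A
    rw [hC1] at h2
    have h3 : adLie hQ one_mem_complexGroup A = A :=
      Subtype.ext (by rw [← mul_one (adLie _ _ _).1, adLie_mul, one_mul])
    rw [h3] at h2
    rw [← h2]
    exact LinearMap.congr_fun h1 _
  rwa [F.chart_zero hQ hQs] at hJ0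

end PeriodDomain

/-! ### Functions constant on integral manifolds -/

namespace PeriodDomain

variable {H : Type*} [AddCommGroup H] [Module ℚ H] [FiniteDimensional ℚ H]
  {Q : LinearMap.BilinForm ℚ H} {n : ℕ} {h : ℕ → ℕ → ℕ} (F : PeriodDomain Q n h)

/-- A map `v ↦ g exp (v X) F` with `X ∈ 𝒢^{-1,1}` nonzero is an integral manifold of `I`. -/
theorem isIntegralManifold_of_mem_gr (hQ : (complexForm Q).Nondegenerate) {X : lieAlg Q}
    (hX : X ∈ F.gr (-1)) (hX0 : X ≠ 0) {g : Module.End ℂ (Complexification H)}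
    (hg : g ∈ complexGroup Q) {S : Set (Fin 1 → ℂ)} (hS : IsOpen S)
    {ψ : (Fin 1 → ℂ) → PeriodDomain Q n h}
    (hψ : ∀ v ∈ S, ∀ p, (ψ v).fil p = (F.fil p).map (g * NormedSpace.exp (v 0 • X.1))) :
    IsIntegralManifold S ψ := by
  refine ⟨hS, fun v hv => ?_⟩
  set k := g * NormedSpace.exp (v 0 • X.1) with hk
  have hexp := exp_smul_mem_complexGroup hQ X.2
  have hkG : k ∈ complexGroup Q := mul_mem_complexGroup hg (hexp _)
  have hgσ := formAdjoint_mem_complexGroup hQ hg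
  have htrans : ∀ z : ℂ, g * NormedSpace.exp (z • X.1) * formAdjoint (complexForm Q) hQ g * k =
      g * NormedSpace.exp ((z + v 0) • X.1) := by
    intro z
    rw [hk, exp_add_smul, mul_assoc _ _ (g * _), ← mul_assoc _ g, (mem_complexGroup_iff hQ).1 hg,
      one_mul, mul_assoc]
  have hfil : ∀ w ∈ S, ∀ p, (ψ w).fil p = ((ψ v).fil p).map
      (g * NormedSpace.exp ((w 0 - v 0) • X.1) * formAdjoint (complexForm Q) hQ g) := by
    intro w hw p
    rw [hψ w hw, hψ v hv, ← Submodule.map_comp, ← Module.End.mul_eq_comp, htrans, sub_add_cancel]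
  have hhol : IsHolomorphicAt ψ v := by
    refine isHolomorphicAt_of_lift hQ (g := fun w =>
      g * NormedSpace.exp ((w 0 - v 0) • X.1) * formAdjoint (complexForm Q) hQ g) ?_ ?_ ?_ ?_
    · have h0 : AnalyticAt ℂ (fun w : Fin 1 → ℂ => w 0) v :=
        (ContinuousLinearMap.proj (R := ℂ) (φ := fun _ : Fin 1 => ℂ) 0).analyticAt v
      have h1 : AnalyticAt ℂ (fun w : Fin 1 → ℂ => (w 0 - v 0) • X.1) v :=
        (h0.sub analyticAt_const).smul analyticAt_const
      have h2 : AnalyticAt ℂ (fun w : Fin 1 → ℂ => NormedSpace.exp ((w 0 - v 0) • X.1)) v :=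
        (NormedSpace.exp_analytic (𝕂 := ℂ) _).comp h1
      exact (analyticAt_const.mul h2).mul analyticAt_const
    · rw [sub_self, zero_smul, NormedSpace.exp_zero, mul_one, mul_formAdjoint_of_mem hQ hg]
    · exact .of_forall fun w => mul_mem_complexGroup (mul_mem_complexGroup hg (hexp _)) hgσ
    · filter_upwards [hS.mem_nhds hv] with w hw
      exact hfil w hw
  have hdiff : ∀ ξ : Fin 1 → ℂ,
      differential ψ v ξ = (ψ v).stab.mkQ (ξ 0 • adLie hQ hg X) := by
    intro ξ
    have hline : HasDerivAt (fun t : ℂ => v + t • ξ) ξ 0 := by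
      simpa using ((hasDerivAt_id (0 : ℂ)).smul_const ξ).const_add v
    refine differential_apply_eq hQ hhol (γ := fun t => v + t • ξ) (by simp) hline
      (δ := fun t => g * NormedSpace.exp ((t * ξ 0) • X.1) * formAdjoint (complexForm Q) hQ g)
      ?_ (hasDerivAt_mul_exp_mul g _ X.1 (ξ 0)) ?_ ?_
    · rw [zero_mul, zero_smul, NormedSpace.exp_zero, mul_one, mul_formAdjoint_of_mem hQ hg]
    · exact .of_forall fun t => mul_mem_complexGroup (mul_mem_complexGroup hg (hexp _)) hgσ
    · have hmem : ∀ᶠ t : ℂ in 𝓝 0, v + t • ξ ∈ S :=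
        hline.continuousAt.eventually_mem (hS.mem_nhds (by simpa using hv))
      filter_upwards [hmem] with t ht p
      rw [hfil _ ht p]
      simp
  -- `X` commutes with `exp(v 0 • X)`, so the velocity can be computed with the element `k` that
  -- moves `F` to `ψ v`.
  have hAd : adLie hQ hg X = adLie hQ hkG X := by
    refine Subtype.ext ?_
    have hcomm : NormedSpace.exp (v 0 • X.1) * X.1 = X.1 * NormedSpace.exp (v 0 • X.1) := by
      let := NormedAlgebra.restrictScalars ℚ ℂ (Module.End ℂ (Complexification H))
      exact (((Commute.refl X.1).smul_left (v 0)).exp_left).eq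
    have h1 : (adLie hQ hg X).1 * k = (adLie hQ hkG X).1 * k := by
      rw [adLie_mul, hk, ← mul_assoc, adLie_mul, mul_assoc, ← hcomm, ← mul_assoc]
    have h2 := congrArg (· * formAdjoint (complexForm Q) hQ k) h1
    simpa only [mul_assoc, mul_formAdjoint_of_mem hQ hkG, mul_one] using h2
  refine ⟨hhol, ?_, ?_⟩
  · refine (injective_iff_map_eq_zero _).2 fun ξ hξ => ?_
    rw [hdiff, map_smul, smul_eq_zero, hAd] at hξ
    rcases hξ with hξ | hξ
    · ext i; rw [Subsingleton.elim i 0, hξ]; rfl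
    · exact absurd ((Submodule.Quotient.mk_eq_zero _).1 hξ)
        (F.adLie_notMem_stab hQ hkG hX hX0 (hψ v hv))
  · rintro _ ⟨ξ, rfl⟩
    rw [hdiff, map_smul, hAd]
    exact Submodule.smul_mem _ _ (F.mkQ_adLie_mem_horizontal hQ hkG hX (hψ v hv))

/-- A smooth function that is constant on integral manifolds is constant near each point, in local
coordinates. -/
theorem eventually_eq_of_const_on_integralManifolds (hh : ∀ p q, p + q = n → h p q ≠ 0)
    (hQ : (complexForm Q).Nondegenerate) (hQs : ∀ u v, Q u v = (-1) ^ n * Q v u)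
    {U : Set (PeriodDomain Q n h)} (hU : IsOpen U) {f : PeriodDomain Q n h → ℂ}
    (hf : IsSmoothOn f U)
    (hconst : ∀ (k : ℕ) (S : Set (Fin k → ℂ)) (ψ : (Fin k → ℂ) → PeriodDomain Q n h),
      IsIntegralManifold S ψ → IsPreconnected S → Set.MapsTo ψ S U →
        ∀ v ∈ S, ∀ w ∈ S, f (ψ v) = f (ψ w)) (hF : F ∈ U) :
    ∀ᶠ x in 𝓝 0, f (F.chart x) = f F := by
  obtain ⟨C, hC, hC1, hCF, hCx⟩ := F.exists_coordinates hQ hQs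
  have hlim : Filter.Tendsto C (𝓝 1) (𝓝 0) := hC1 ▸ hC.continuousAt
  set f' : Module.End ℂ (Complexification H) → ℂ := fun g => f (F.chart (C g)) with hf'
  have hfs : ContDiffAt ℝ 2 f' 1 := by
    have h1 : ContDiffAt ℝ 2 (fun x => f (F.chart x)) (C 1) := by
      rw [hC1]; exact_mod_cast contDiffAt_infty.1 (hf F hF) 2
    exact h1.comp 1 ((hC.restrict_scalars ℝ).of_le le_top)
  have hfe := hfs.eventually (by simp)
  have hgr : ∀ X ∈ F.gr (-1), ∀ᶠ g in 𝓝 1, g ∈ complexGroup Q →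
      ∀ _ : Unit, fderiv ℝ f' g (g * X.1) = 0 := by
    intro X hX
    by_cases hX0 : X = 0
    · refine .of_forall fun g _ _ => ?_
      rw [hX0, ZeroMemClass.coe_zero, mul_zero, map_zero]
    obtain ⟨O, hO, hOo, hO1⟩ := eventually_nhds_iff.1 (hCF.and (hlim.eventually (hU F hF)))
    filter_upwards [hOo.mem_nhds hO1, hfe] with g hgO hfg hg _
    have hcurve : Continuous fun t : ℂ => g * NormedSpace.exp (t • X.1) :=
      continuous_const.mul (continuous_exp_banach.comp (continuous_id.smul continuous_const))
    have hT : ∀ᶠ t : ℂ in 𝓝 0, g * NormedSpace.exp (t • X.1) ∈ O :=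
      hcurve.continuousAt.eventually_mem (hOo.mem_nhds (by simpa using hgO))
    obtain ⟨ε, hε, hball⟩ := Metric.eventually_nhds_iff_ball.1 hT
    have hmem : ∀ v ∈ Metric.ball (0 : Fin 1 → ℂ) ε,
        g * NormedSpace.exp (v 0 • X.1) ∈ O := by
      intro v hv
      refine hball _ (mem_ball_zero_iff.2 ((norm_le_pi_norm v 0).trans_lt (mem_ball_zero_iff.1 hv)))
    have hc := hconst 1 (Metric.ball 0 ε) (fun v => F.chart (C (g * NormedSpace.exp (v 0 • X.1))))
      (F.isIntegralManifold_of_mem_gr hQ hX hX0 hg Metric.isOpen_ball fun v hv =>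
        (hO _ (hmem v hv)).1 (mul_mem_complexGroup hg (exp_smul_mem_complexGroup hQ X.2 _)))
      (convex_ball _ _).isPreconnected (fun v hv => (hO _ (hmem v hv)).2)
    -- The integral manifold is a complex disc. Its real diameter already yields `df (g X) = 0`;
    -- multiples of `X` by `i` are covered since `X` ranges over a complex space.
    have hd : HasDerivAt (fun t : ℝ => g * NormedSpace.exp (t • X.1)) (g * X.1) 0 := by
      simpa using (hasDerivAt_exp_smul_const X.1 (0 : ℝ)).const_mul g
    have h0 : g * NormedSpace.exp ((0 : ℝ) • X.1) = g := by simp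
    have hfd : HasFDerivAt f' (fderiv ℝ f' g) g := (hfg.differentiableAt (by simp)).hasFDerivAt
    have hev : (fun t : ℝ => f' (g * NormedSpace.exp (t • X.1))) =ᶠ[𝓝 0] fun _ => f' g := by
      filter_upwards [Metric.ball_mem_nhds (0 : ℝ) hε] with t ht
      have h1 := hc (fun _ => (t : ℂ)) (by
        rw [mem_ball_zero_iff] at ht ⊢
        rw [pi_norm_lt_iff hε]
        intro i
        simpa using ht) 0 (Metric.mem_ball_self hε)
      simp only [Pi.zero_apply, zero_smul, NormedSpace.exp_zero, mul_one] at h1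
      exact h1
    have hcomp : HasDerivAt (fun t : ℝ => f' (g * NormedSpace.exp (t • X.1)))
        (fderiv ℝ f' g (g * X.1)) 0 := hfd.comp_hasDerivAt_of_eq (0 : ℝ) hd h0.symm
    exact hcomp.unique
      ((hasDerivAt_const (0 : ℝ) (f' g)).congr_of_eventuallyEq hev)
  have hvan : ∀ A ∈ F.compl, ∀ᶠ g in 𝓝 1, g ∈ complexGroup Q → fderiv ℝ f' g (g * A) = 0 := by
    intro A hA
    have := F.eventually_form_eq_zero_of_mem_compl hh hQ hQs (𝕜 := ℝ) (ι := Unit)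
      (fun X hX t => exp_smul_mem_complexGroup hQ hX (t : ℂ))
      (fun _ g => fderiv ℝ f' g) ?_ hgr ?_ hA
    · exact this.mono fun g hg hgG => hg hgG ()
    · filter_upwards [hfe] with g hg _
      exact (hg.fderiv_right (m := 1) (by norm_num)).differentiableAt (by simp)
    · filter_upwards [hfe] with g hg u v _ _ _
      exact (hg.isSymmSndFDerivAt (by simp)).eq u v
  have hall : ∀ᶠ g in 𝓝 1, g ∈ complexGroup Q → ∀ x, fderiv ℝ f' g (g * F.coord x) = 0 := by
    -- The neighbourhood depends on `A`, and `df` is only real linear. A finite real basis of `𝔭`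
    -- gives one neighbourhood valid for all directions.
    have h1 : ∀ᶠ g in 𝓝 1, ∀ i : Fin F.dim, ∀ c ∈ ({1, Complex.I} : Finset ℂ),
        g ∈ complexGroup Q → fderiv ℝ f' g (g * F.coord (Pi.single i c)) = 0 :=
      Filter.eventually_all.2 fun i => (Filter.eventually_all_finset _).2 fun c _ =>
        hvan _ (F.coord_mem_compl _)
    filter_upwards [h1] with g hg hgG x
    have hx : x = ∑ i, ((x i).re • (Pi.single i 1 : Fin F.dim → ℂ) +
        (x i).im • (Pi.single i Complex.I : Fin F.dim → ℂ)) := by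
      ext j
      simp only [Finset.sum_apply, Pi.add_apply, Pi.smul_apply, Pi.single_apply]
      rw [Finset.sum_eq_single_of_mem j (Finset.mem_univ j) (fun i _ hij => by
        simp [hij.symm])]
      simp
    let M : (Fin F.dim → ℂ) →L[ℝ] ℂ := (fderiv ℝ f' g).comp
      (((ContinuousLinearMap.mul ℂ _ g).comp F.coordL).restrictScalars ℝ)
    change M x = 0
    rw [hx, map_sum]
    refine Finset.sum_eq_zero fun i _ => ?_
    rw [map_add, map_smul, map_smul]
    have e1 : M (Pi.single i 1) = 0 := hg i 1 (by simp) hgG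
    have e2 : M (Pi.single i Complex.I) = 0 := hg i Complex.I (by simp) hgG
    rw [e1, e2, smul_zero, smul_zero, add_zero]
  obtain ⟨ε, hε, hball⟩ := Metric.eventually_nhds_iff_ball.1
    (F.tendsto_exp_coord.eventually (hall.and hfe))
  filter_upwards [Metric.ball_mem_nhds _ hε, hCx] with x hx hCx
  -- The velocity of the ray `exp(tA)` is `exp(tA) A`, a left invariant vector with `A ∈ 𝔭`, so `df`
  -- kills it.
  have hd : ∀ t ∈ Set.Icc (0 : ℝ) 1,
      HasDerivAt (fun t : ℝ => f' (NormedSpace.exp (t • F.coord x))) 0 t := by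
    intro t ht
    have htx : (t : ℂ) • x ∈ Metric.ball 0 ε := by
      rw [mem_ball_zero_iff] at hx ⊢
      rw [norm_smul, Complex.norm_real, Real.norm_of_nonneg ht.1]
      exact (mul_le_of_le_one_left (norm_nonneg _) ht.2).trans_lt hx
    have h1 := hball _ htx
    have hc : F.coord ((t : ℂ) • x) = t • F.coord x := by
      rw [← coordL_apply, map_smul]; rfl
    rw [hc] at h1
    have h2 := (h1.2.differentiableAt (by simp)).hasFDerivAt.comp_hasDerivAt t
      (hasDerivAt_exp_smul_const (F.coord x) t)
    refine h2.congr_deriv (h1.1 ?_ x)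
    rw [← hc]
    exact F.exp_coord_mem_complexGroup hQ _
  have h1 := constant_of_has_deriv_right_zero
    (fun t ht => (hd t ht).continuousAt.continuousWithinAt)
    (fun t ht => (hd t ⟨ht.1, ht.2.le⟩).hasDerivWithinAt) 1 ⟨zero_le_one, le_rfl⟩
  simp only [one_smul, zero_smul, NormedSpace.exp_zero, hf', hCx, hC1] at h1
  rw [h1, F.chart_zero hQ hQs]

/-- Open sets are defined through the charts, so each level set of `f` in `U` and its complement in
`U` are open. -/
theorem eq_of_locally_constant {U : Set (PeriodDomain Q n h)} (hU : IsOpen U)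
    (hUc : IsPreconnected U) {f : PeriodDomain Q n h → ℂ}
    (hf : ∀ F ∈ U, ∀ᶠ x in 𝓝 0, f (F.chart x) = f F) {F F' : PeriodDomain Q n h} (hF : F ∈ U)
    (hF' : F' ∈ U) : f F = f F' := by
  have hopen : ∀ P : ℂ → Prop, IsOpen {G | G ∈ U ∧ P (f G)} := by
    intro P G hG
    filter_upwards [hU G hG.1, hf G hG.1] with x hx hx'
    exact ⟨hx, hx' ▸ hG.2⟩
  have hsub := hUc.subset_left_of_subset_union (hopen (· = f F)) (hopen (· ≠ f F))
    (Set.disjoint_left.2 fun G h1 h2 => h2.2 h1.2)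
    (fun G hG => (em (f G = f F)).imp (⟨hG, ·⟩) (⟨hG, ·⟩)) ⟨F, hF, hF, rfl⟩
  exact (hsub hF').2.symm

end PeriodDomain

end

theorem mainTheorem12 {H : Type*} [AddCommGroup H] [Module ℚ H] [FiniteDimensional ℚ H]
    (n : ℕ) (hn : 2 ≤ n) (Q : LinearMap.BilinForm ℚ H) (hQ : Q.Nondegenerate)
    (hQsymm : ∀ u v, Q u v = (-1) ^ n * Q v u)
    (h : ℕ → ℕ → ℕ) (hh : ∀ p q, p + q = n → h p q ≠ 0) :
    (∀ U : Set (PeriodDomain Q n h), IsOpen U →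
      ∀ J : ∀ F : PeriodDomain Q n h, Submodule ℂ (Module.Dual ℂ F.Tangent),
        PeriodDomain.IsPfaffianSystemOn J U →
        (∀ F ∈ U, J F ≤ F.periodRelation) →
        PeriodDomain.IsCompletelyIntegrableOn J U →
        ∀ F ∈ U, J F = ⊥) ∧
    (∀ U : Set (PeriodDomain Q n h), IsOpen U → IsPreconnected U →
      ∀ f : PeriodDomain Q n h → ℂ, PeriodDomain.IsSmoothOn f U →
        (∀ (k : ℕ) (S : Set (Fin k → ℂ)) (ψ : (Fin k → ℂ) → PeriodDomain Q n h),
          PeriodDomain.IsIntegralManifold S ψ → IsPreconnected S → Set.MapsTo ψ S U →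
          ∀ v ∈ S, ∀ w ∈ S, f (ψ v) = f (ψ w)) →
        ∀ F ∈ U, ∀ F' ∈ U, f F = f F') := by
  have hQ' := complexForm_nondegenerate hQ
  refine ⟨fun U hU J hJ hJI hJU F hF =>
    F.eq_bot_of_completelyIntegrable hh hQ' hQsymm hU hJ hJI hJU hF, ?_⟩
  intro U hU hUc f hf hconst F hF F' hF'
  exact PeriodDomain.eq_of_locally_constant hU hUc (fun G hG =>
    G.eventually_eq_of_const_on_integralManifolds hh hQ' hQsymm hU hf hconst hG) hF hF'
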